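/- Throughout, $\log=\ln$ is the natural logarithm, and graphs are simple and undirected with node set $[n]=\{1,\dots,n\}$, $n\ge 1$. Two graphs are *node neighbors* if they differ only in edges incident to a single node. Random variables $X,Y$ are *$(\varepsilon,\delta)$-indistinguishable* if $\Pr[X\in S]\le e^{\varepsilon}\Pr[Y\in S]+\delta$ and $\Pr[Y\in S]\le e^{\varepsilon}\Pr[X\in S]+\delta$ for every event $S$. A randomized algorithm $\mathcal A$ on graphs is *$(\varepsilon,\delta)$-LNDP* (noninteractive local node differentially private) if there are a distribution of public randomness $\rho$, local randomizers $\mathcal R_{1,\rho},\dots,\mathcal R_{n,\rho}$ with independent coins and a randomized postprocessing algorithm $\mathcal P$ such that for every graph $G$ the output $\mathcal A(G)$ is distributed as $\mathcal P(\mathcal R_{1,\rho}(N_1),\dots,\mathcal R_{n,\rho}(N_n))$, where $N_i$ is the neighborhood of node $i$ in $G$, and such that for every value of $\rho$ the vectors of reports $(\mathcal R_{i,\rho}(N_i))_{i\in[n]}$ on any two node-neighboring graphs are $(\varepsilon,\delta)$-indistinguishable. **Algorithm.** Let $c_1>0$, $0<\varepsilon\le 1$, $0<\delta\le\frac12$,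 and put $c_{\varepsilon,\delta}=\sqrt{\log(1/\delta)}/\varepsilon$, $s=\lceil 2\sqrt{3n\ln(10n)}\,\rceil$ and $\nu=\lceil n/s\rceil+1$. The algorithm $\mathcal A^{\mathrm{ER}}$ with these parameters does the following on a graph $G$. 1. Each node $i$, with degree $d_i$, reports a vector $\hat r_i\in\mathbb R^{\nu}$ with independent entries $\hat r_{i,j}\sim\mathcal N\bigl(\max\{1-|d_i-sj|/s,\,0\},\ \tilde\sigma^2\bigr)$, $0\le j\le\nu-1$, where $\tilde\sigma^2=4\,(1+n/s^2)\,c_{\varepsilon,\delta}^2$. 2. The server computes $\hat v=\frac1n\sum_{i=1}^n\hat r_i$, with the convention $\hat v_j=0$ for $j\notin\{0,\dots,\nu-1\}$. 3. Let $j^*$ be the (least) index in $\{1,\dots,\nu-1\}$ at which $\hat v_j$ is largest. Set $\hat\jmath=j^*$ if $\hat v_{j^*}\ge c_1\sqrt{\log(n/s)/n}\;c_{\varepsilon,\delta}$, and $\hat\jmath=0$ otherwise (with $\sqrt{x}$ read as $0$ for $x<0$). 4. The server outputs $\hat p=\frac1n\bigl(s(\hat\jmath-2)+\sum_{i=1}^{4}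 i\,s\,\hat v_{\hat\jmath-2+i}\bigr)$. **Theorem.** There are absolute constants $c,c_1,C>0$ and $n_0\in\mathbb N$ such that the following holds for all $n\ge1$, $\delta\in(0,\frac12]$ and $\varepsilon\in(0,1]$ with $\varepsilon\ge c\sqrt{\frac{\log n\,\log(1/\delta)}{n}}$. The algorithm $\mathcal A^{\mathrm{ER}}$ with parameters $c_1,\varepsilon,\delta,n$ is $(\varepsilon,\delta)$-LNDP (privacy holds for all graphs on $[n]$). Moreover, if $n\ge n_0$, then for every $p\in[0,1]$, $$\Pr\Bigl[\,\bigl|\mathcal A^{\mathrm{ER}}(G)-p\bigr|\le C\cdot\frac{\sqrt{\log n}}{n}\cdot\frac{\sqrt{\log(1/\delta)}}{\varepsilon}\Bigr]\ \ge\ \frac23,$$ where the probability is over $G\sim G(n,p)$ and the randomness of $\mathcal A^{\mathrm{ER}}$. -/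

import Mathlib

open MeasureTheory ProbabilityTheory

namespace NodeLDP

/-! ### Local node differential privacy -/

/-- Two graphs on the same node set are node neighbors if they differ only in edges incident to
a single node. -/
def NodeNeighbors {n : ℕ} (G G' : SimpleGraph (Fin n)) : Prop :=
  ∃ i : Fin n, ∀ u v : Fin n, u ≠ i → v ≠ i → (G.Adj u v ↔ G'.Adj u v)

/-- `(ε, δ)`-indistinguishability of two laws on the same outcome space. -/
def Indistinguishable {Y : Type*} [MeasurableSpace Y] (ε δ : ℝ) (μ ν : Measure Y) : Prop :=
  ∀ S : Set Y, MeasurableSet S →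
    μ S ≤ ENNReal.ofReal (Real.exp ε) * ν S + ENNReal.ofReal δ ∧
    ν S ≤ ENNReal.ofReal (Real.exp ε) * μ S + ENNReal.ofReal δ

/-- The joint law of the reports of all nodes on the input graph `G`, when node `i` runs its local
randomizer, independently of the other nodes, on its own neighborhood; `R i N` is the law of the
report of node `i` on neighborhood `N`. -/
noncomputable def jointReports {n : ℕ} {Z : Type*} [MeasurableSpace Z]
    (R : Fin n → Set (Fin n) → Measure Z) (G : SimpleGraph (Fin n)) : Measure (Fin n → Z) :=
  Measure.pi fun i => R i (G.neighborSet i)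

/-- A randomized algorithm on graphs with node set `Fin n`, given by its output law on each input,
is (noninteractive) `(ε, δ)`-LNDP: there are a distribution `μ` of the public randomness `ω`, local
randomizers `R i · ω` and a randomized postprocessing `P` of the vector of reports that together
represent the algorithm, and, for every value of the public randomness, the joint laws of the
reports on node-neighboring graphs are `(ε, δ)`-indistinguishable. -/
def IsLNDP {n : ℕ} {Y : Type*} [MeasurableSpace Y] (ε δ : ℝ)
    (A : SimpleGraph (Fin n) → Measure Y) : Prop :=
  ∃ (Ω Z : Type) (_ : MeasurableSpace Ω) (_ : MeasurableSpace Z) (μ : Measure Ω)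
    (R : Fin n → Set (Fin n) → Kernel Ω Z) (P : Kernel (Fin n → Z) Y),
    IsProbabilityMeasure μ ∧ (∀ i N, IsMarkovKernel (R i N)) ∧ IsMarkovKernel P ∧
    (∀ G : SimpleGraph (Fin n),
      A G = (μ.bind fun ω => jointReports (fun i N => R i N ω) G).bind P) ∧
    ∀ G G' : SimpleGraph (Fin n), NodeNeighbors G G' → ∀ ω : Ω,
      Indistinguishable ε δ (jointReports (fun i N => R i N ω) G)
        (jointReports (fun i N => R i N ω) G')

/-! ### The algorithm -/

/-- `√(log (1/δ)) / ε`. -/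
noncomputable def privacyFactor (ε δ : ℝ) : ℝ := Real.sqrt (Real.log (1 / δ)) / ε

/-- The number `⌈n / s⌉ + 1` of multiples of `s` to which degrees are rounded. -/
noncomputable def numCells (n s : ℕ) : ℕ := ⌈(n : ℝ) / (s : ℝ)⌉₊ + 1

/-- The probability that the unbiased randomized rounding of `d` to a multiple of `s` is `s * j`
(an entry of the blur matrix). -/
noncomputable def blurProb (s d j : ℕ) : ℝ :=
  max (1 - |(d : ℝ) - (s : ℝ) * (j : ℝ)| / (s : ℝ)) 0

/-- The per-coordinate noise variance `4 (1 + n / s²) log (1/δ) / ε²`, i.e. that of the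
linear-query algorithm for the identity workload (whose `1 → 2` norm is `1`). -/
noncomputable def noiseVariance (ε δ : ℝ) (n s : ℕ) : NNReal :=
  (4 * (1 + (n : ℝ) / (s : ℝ) ^ 2) * privacyFactor ε δ ^ 2).toNNReal

/-- The local randomizer: a node with neighborhood `N` reports the column of the blur matrix
that belongs to its degree, plus independent Gaussian noise in each coordinate. -/
noncomputable def blurReport (ε δ : ℝ) (n s : ℕ) (N : Set (Fin n)) :
    Measure (Fin (numCells n s) → ℝ) :=
  Measure.pi fun j => gaussianReal (blurProb s N.ncard j) (noiseVariance ε δ n s)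

/-- The law of the estimate of the compressed blurry degree distribution: the average of the
reports of all nodes. -/
noncomputable def blurryPMF (ε δ : ℝ) (n s : ℕ) (G : SimpleGraph (Fin n)) :
    Measure (Fin (numCells n s) → ℝ) :=
  (jointReports (fun _ N => blurReport ε δ n s N) G).map fun r j => (∑ i, r i j) / (n : ℝ)

/-- A vector indexed by `0, …, m - 1`, extended by `0` to all integer indices. -/
def padZero {m : ℕ} (v : Fin m → ℝ) (j : ℤ) : ℝ :=
  if h : j.toNat < m then (if 0 ≤ j then v ⟨j.toNat, h⟩ else 0) else 0

/-- The (least) index of a largest entry among the entries of `v` with index `1, …, m - 1`. -/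
noncomputable def argmaxNonzero {m : ℕ} (v : Fin m → ℝ) : ℕ :=
  sInf {j : ℕ | j ∈ Finset.Icc 1 (m - 1) ∧
    ∀ k ∈ Finset.Icc 1 (m - 1), padZero v (k : ℤ) ≤ padZero v (j : ℤ)}

/-- The selected index: the index of the largest entry with nonzero index if that entry reaches
the threshold `c₁ √(log (n/s) / n) √(log (1/δ)) / ε`, and `0` otherwise. -/
noncomputable def selectedIndex (c₁ ε δ : ℝ) (n s : ℕ) (v : Fin (numCells n s) → ℝ) : ℕ :=
  open Classical in
  if c₁ * Real.sqrt (Real.log ((n : ℝ) / (s : ℝ)) / (n : ℝ)) * privacyFactor ε δ ≤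
      padZero v (argmaxNonzero v : ℤ)
  then argmaxNonzero v else 0

/-- The postprocessing of the estimated distribution `v` by the concentrated-degree algorithm:
with selected index `j`, the pair of `s (j - 2)` and `∑_{i = 1}^{4} i s v_{j - 2 + i}`. -/
noncomputable def concDegServer (c₁ ε δ : ℝ) (n s : ℕ) (v : Fin (numCells n s) → ℝ) : ℝ × ℝ :=
  ((s : ℝ) * ((selectedIndex c₁ ε δ n s v : ℝ) - 2),
    ∑ i ∈ Finset.Icc (1 : ℕ) 4,
      (i : ℝ) * (s : ℝ) * padZero v ((selectedIndex c₁ ε δ n s v : ℤ) - 2 + (i : ℤ)))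

/-- The output law of the average-degree estimator for concentrated-degree graphs. -/
noncomputable def concDeg (c₁ ε δ : ℝ) (n s : ℕ) (G : SimpleGraph (Fin n)) : Measure (ℝ × ℝ) :=
  (blurryPMF ε δ n s G).map (concDegServer c₁ ε δ n s)

/-- The width `⌈2 √(3 n ln (10 n))⌉`. -/
noncomputable def erWidth (n : ℕ) : ℕ :=
  ⌈2 * Real.sqrt (3 * (n : ℝ) * Real.log (10 * (n : ℝ)))⌉₊

/-- The output law of the estimator of the Erdős–Rényi parameter. -/
noncomputable def erEstimator (c₁ ε δ : ℝ) (n : ℕ) (G : SimpleGraph (Fin n)) : Measure ℝ :=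
  (concDeg c₁ ε δ n (erWidth n) G).map fun y => (y.1 + y.2) / (n : ℝ)

end NodeLDP

/-! Privacy. The vector of all reports is a Gaussian vector, so changing the graph only shifts its
mean. The changed node moves its blur column by at most 2 in squared norm. Every other degree
changes by at most 1, which moves two adjacent entries by `1/s` each. The total squared shift is at
most `2(1 + n/s²)`, which is why a noise variance proportional to `1 + n/s²` suffices. Moments of
the likelihood ratio multiply over independent coordinates (`HasMomentDensity.pi`), and a moment
bound turns into `(ε, δ)` by a pointwise Bernoulli inequality (`HasMomentDensity.measure_le`).

Accuracy. Blurring is linear interpolation on the grid `sℤ`, so summing grid point times blurred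
mass over a window containing all degrees returns the average degree exactly (`sum_tent_window`).
For `G(n,p)`, Hoeffding puts every degree within `6s/25` of `p(n-1)` and the average degree within 2
of it. Under such concentration, and with noise uniformly below half the threshold, the selected
index gives a window containing all degrees (`selectedIndex_window`).

The rate rests on using two noise bounds. The uniform one, of order `√(log(n/s)/n)`, serves only to
locate the window. The window then lies among boundedly many indices around `p(n-1)/s`, fixed before
the noise is drawn, where a bound of order `√(1/n)` holds. Multiplying by `s ≈ √(n log n)` leaves
`√(log n)` in the average degree, whereas the uniform bound alone would leave an additional factor
`√(log(n/s))`. -/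

namespace NodeLDP

/-! ### Privacy of the Gaussian mechanism -/

/-- The law `μ` has a density with respect to `ν` whose `a`-th moment is at most `exp K`. -/
def HasMomentDensity {α : Type*} [MeasurableSpace α] (a K : ℝ) (μ ν : Measure α) : Prop :=
  ∃ f : α → ENNReal, Measurable f ∧ μ = ν.withDensity f ∧
    ∫⁻ x, f x ^ a ∂ν ≤ ENNReal.ofReal (Real.exp K)

theorem lintegral_pi_prod {ι : Type*} [Fintype ι] {α : ι → Type*} [∀ i, MeasurableSpace (α i)]
    (ν : ∀ i, Measure (α i)) [∀ i, IsProbabilityMeasure (ν i)] (f : ∀ i, α i → ENNReal)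
    (hf : ∀ i, Measurable (f i)) :
    ∫⁻ x, ∏ i, f i (x i) ∂(Measure.pi ν) = ∏ i, ∫⁻ x, f i x ∂(ν i) := by
  have h := lintegral_prod_eq_prod_lintegral_of_indepFun (μ := Measure.pi ν) Finset.univ
    (fun i (x : ∀ i, α i) => f i (x i)) (iIndepFun_pi fun i => (hf i).aemeasurable)
    (fun i => (hf i).comp (measurable_pi_apply i))
  rw [h]
  exact Finset.prod_congr rfl fun i _ => (measurePreserving_eval ν i).lintegral_comp (hf i)

theorem pi_withDensity {ι : Type*} [Fintype ι] {α : ι → Type*} [∀ i, MeasurableSpace (α i)]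
    (ν : ∀ i, Measure (α i)) [∀ i, IsProbabilityMeasure (ν i)] (f : ∀ i, α i → ENNReal)
    (hf : ∀ i, Measurable (f i)) [∀ i, IsProbabilityMeasure ((ν i).withDensity (f i))] :
    Measure.pi (fun i => (ν i).withDensity (f i)) =
      (Measure.pi ν).withDensity fun x => ∏ i, f i (x i) := by
  refine Measure.pi_eq fun s hs => ?_
  rw [withDensity_apply _ (MeasurableSet.univ_pi hs),
    ← lintegral_indicator (MeasurableSet.univ_pi hs)]
  have h : (Set.univ.pi s).indicator (fun x : ∀ i, α i => ∏ i, f i (x i)) =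
      fun x => ∏ i, (s i).indicator (f i) (x i) := by
    funext x
    by_cases hx : x ∈ Set.univ.pi s
    · rw [Set.indicator_of_mem hx]
      exact Finset.prod_congr rfl fun i _ => (Set.indicator_of_mem (hx i trivial) _).symm
    · rw [Set.indicator_of_notMem hx]
      simp only [Set.mem_pi, not_forall] at hx
      obtain ⟨i, _, hi⟩ := hx
      exact (Finset.prod_eq_zero (Finset.mem_univ i) (Set.indicator_of_notMem hi _)).symm
  rw [h, lintegral_pi_prod ν _ fun i => (hf i).indicator (hs i)]
  refine Finset.prod_congr rfl fun i _ => ?_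
  rw [lintegral_indicator (hs i), withDensity_apply _ (hs i)]

/-- The density of a product law is the product of the densities, and its moment factors by
independence, so the exponents add. Privacy uses this twice: over coordinates of a report and over
nodes. -/
theorem HasMomentDensity.pi {ι : Type*} [Fintype ι] {α : ι → Type*}
    [∀ i, MeasurableSpace (α i)] {a : ℝ} (ha : 0 ≤ a) {K : ι → ℝ} {μ ν : ∀ i, Measure (α i)}
    [hμ : ∀ i, IsProbabilityMeasure (μ i)] [∀ i, IsProbabilityMeasure (ν i)]
    (h : ∀ i, HasMomentDensity a (K i) (μ i) (ν i)) :
    HasMomentDensity a (∑ i, K i) (Measure.pi μ) (Measure.pi ν) := by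
  choose f hf hμν hK using h
  have : ∀ i, IsProbabilityMeasure ((ν i).withDensity (f i)) := fun i => hμν i ▸ hμ i
  refine ⟨fun x => ∏ i, f i (x i),
    Finset.measurable_prod _ fun i _ => (hf i).comp (measurable_pi_apply i), ?_, ?_⟩
  · rw [← pi_withDensity ν f hf]
    exact congrArg Measure.pi (funext hμν)
  · simp_rw [← ENNReal.prod_rpow_of_nonneg ha]
    rw [lintegral_pi_prod ν (fun i x => f i x ^ a) fun i => (hf i).pow_const a, Real.exp_sum,
      ENNReal.ofReal_prod_of_nonneg fun i _ => (Real.exp_pos _).le]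
    exact Finset.prod_le_prod' fun i _ => hK i

/-- With equal variances the quadratic terms of the log-likelihood ratio cancel. The ratio is the
exponential of an affine function, and its moment is a value of the Gaussian moment generating
function. -/
theorem hasMomentDensity_gaussianReal (a : ℝ) (x y : ℝ) {v : NNReal} (hv : v ≠ 0) :
    HasMomentDensity a (a * (a - 1) * (x - y) ^ 2 / (2 * v)) (gaussianReal x v)
      (gaussianReal y v) := by
  have hv' : (v : ℝ) ≠ 0 := by exact_mod_cast hv
  have hm : Measurable fun z : ℝ =>
      ENNReal.ofReal (Real.exp (((z - y) ^ 2 - (z - x) ^ 2) / (2 * v))) := by fun_prop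
  refine ⟨_, hm, ?_, ?_⟩
  · rw [gaussianReal_of_var_ne_zero x hv, gaussianReal_of_var_ne_zero y hv,
      ← withDensity_mul _ (measurable_gaussianPDF y v) hm]
    congr 1
    funext z
    simp only [gaussianPDF, gaussianPDFReal, Pi.mul_apply]
    rw [← ENNReal.ofReal_mul (by positivity), mul_assoc _ (Real.exp _) (Real.exp _), ← Real.exp_add]
    congr 3
    field_simp
    ring
  · have h : ∀ z : ℝ, ENNReal.ofReal (Real.exp (((z - y) ^ 2 - (z - x) ^ 2) / (2 * v))) ^ a =
        ENNReal.ofReal (Real.exp (a * (y ^ 2 - x ^ 2) / (2 * v))) *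
          ENNReal.ofReal (Real.exp (a * (x - y) / v * z)) := by
      intro z
      rw [ENNReal.ofReal_rpow_of_pos (Real.exp_pos _), ← Real.exp_mul,
        ← ENNReal.ofReal_mul (Real.exp_pos _).le, ← Real.exp_add]
      congr 2
      field_simp
      ring
    simp_rw [h]
    rw [lintegral_const_mul _ (by fun_prop), ← ofReal_integral_eq_lintegral_ofReal
      (integrable_exp_mul_gaussianReal _) (ae_of_all _ fun _ => (Real.exp_pos _).le)]
    have h2 := congrFun (mgf_fun_id_gaussianReal (μ := y) (v := v)) (a * (x - y) / v)
    rw [mgf] at h2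
    rw [h2, ← ENNReal.ofReal_mul (Real.exp_pos _).le, ← Real.exp_add]
    refine le_of_eq ?_
    congr 2
    field_simp
    ring

/-- For `u = f * exp (-ε)` this is Bernoulli's inequality `1 + (1 + l)(u - 1) ≤ u ^ (1 + l)`,
rescaled. The gain `1 / (1 + l)` over a plain Markov bound is needed later to reach exactly `δ`. -/
theorem le_exp_add_rpow {ε l : ℝ} (hl : 0 < l) (f : ENNReal) :
    f ≤ ENNReal.ofReal (Real.exp ε) +
      ENNReal.ofReal (Real.exp (-(l * ε)) / (1 + l)) * f ^ (1 + l) := by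
  rcases eq_or_ne f ⊤ with rfl | hf
  · rw [ENNReal.top_rpow_of_pos (by linarith), ENNReal.mul_top]
    · simp
    · simp only [ne_eq, ENNReal.ofReal_eq_zero, not_le]; positivity
  · lift f to NNReal using hf
    obtain ⟨u, hu⟩ : ∃ u : ℝ, u = f * Real.exp (-ε) := ⟨_, rfl⟩
    have hu0 : 0 ≤ u := by rw [hu]; positivity
    have hfu : (f : ℝ) = u * Real.exp ε := by
      rw [hu, mul_assoc, ← Real.exp_add]; simp
    have hb := one_add_mul_self_le_rpow_one_add (s := u - 1) (by linarith) (p := 1 + l)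
      (by linarith)
    rw [add_sub_cancel] at hb
    have hreal : (f : ℝ) ≤ Real.exp ε + Real.exp (-(l * ε)) / (1 + l) * (f : ℝ) ^ (1 + l) := by
      rw [hfu, Real.mul_rpow hu0 (Real.exp_pos _).le, ← Real.exp_mul]
      have he : Real.exp (-(l * ε)) / (1 + l) * (u ^ (1 + l) * Real.exp (ε * (1 + l))) =
          Real.exp ε * (u ^ (1 + l) / (1 + l)) := by
        have : Real.exp (-(l * ε)) * Real.exp (ε * (1 + l)) = Real.exp ε := by
          rw [← Real.exp_add]; congr 1; ring
        rw [← this]; ring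
      rw [he]
      have : u ≤ 1 + u ^ (1 + l) / (1 + l) := by
        rw [← sub_le_iff_le_add', le_div_iff₀ (by linarith)]
        linarith
      nlinarith [Real.exp_pos ε]
    calc (f : ENNReal) = ENNReal.ofReal (f : ℝ) := by simp
      _ ≤ _ := ENNReal.ofReal_le_ofReal hreal
      _ = _ := by
        rw [ENNReal.ofReal_add (by positivity) (by positivity), ENNReal.ofReal_mul (by positivity),
          ← ENNReal.ofReal_rpow_of_nonneg (by positivity) (by linarith)]
        simp

theorem HasMomentDensity.measure_le {α : Type*} [MeasurableSpace α] {μ ν : Measure α}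
    {l K ε δ : ℝ} (hl : 0 < l) (h : HasMomentDensity (1 + l) K μ ν)
    (hδ : Real.exp (K - l * ε) ≤ (1 + l) * δ) {S : Set α} (hS : MeasurableSet S) :
    μ S ≤ ENNReal.ofReal (Real.exp ε) * ν S + ENNReal.ofReal δ := by
  obtain ⟨f, hf, rfl, hK⟩ := h
  rw [withDensity_apply _ hS]
  calc ∫⁻ x in S, f x ∂ν
      ≤ ∫⁻ x in S, (ENNReal.ofReal (Real.exp ε) +
          ENNReal.ofReal (Real.exp (-(l * ε)) / (1 + l)) * f x ^ (1 + l)) ∂ν :=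
        lintegral_mono fun x => le_exp_add_rpow hl _
    _ = ENNReal.ofReal (Real.exp ε) * ν S +
          ENNReal.ofReal (Real.exp (-(l * ε)) / (1 + l)) * ∫⁻ x in S, f x ^ (1 + l) ∂ν := by
        rw [lintegral_add_left measurable_const, setLIntegral_const,
          lintegral_const_mul _ (hf.pow_const _)]
    _ ≤ ENNReal.ofReal (Real.exp ε) * ν S +
          ENNReal.ofReal (Real.exp (-(l * ε)) / (1 + l)) * ENNReal.ofReal (Real.exp K) := by
        gcongr
        exact (setLIntegral_le_lintegral _ _).trans hK
    _ ≤ _ := by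
        gcongr
        rw [← ENNReal.ofReal_mul (by positivity)]
        apply ENNReal.ofReal_le_ofReal
        rw [div_mul_eq_mul_div, ← Real.exp_add, div_le_iff₀ (by linarith)]
        rw [neg_add_eq_sub, mul_comm δ]
        exact hδ

/-! ### Sensitivity of the blurry degree vectors -/

/-- The tent function. -/
noncomputable def tent (x : ℝ) : ℝ := max (1 - |x|) 0

theorem tent_nonneg (x : ℝ) : 0 ≤ tent x := le_max_right _ _

theorem tent_le_one (x : ℝ) : tent x ≤ 1 := max_le (by linarith [abs_nonneg x]) zero_le_one

theorem blurProb_eq_tent {s : ℕ} (hs : 0 < s) (d j : ℕ) :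
    blurProb s d j = tent ((d : ℝ) / s - (j : ℤ)) := by
  have hs' : (0 : ℝ) < s := by exact_mod_cast hs
  have h : (d : ℝ) / s - (j : ℤ) = ((d : ℝ) - s * j) / s := by
    push_cast
    field_simp
  rw [blurProb, tent, h, abs_div, abs_of_pos hs']

/-- On a closed cell only the tents at its two endpoints are nonzero, and both are affine.
Sensitivity and exact reconstruction both come from this formula. -/
theorem tent_sub_int {x : ℝ} {q : ℤ} (h1 : (q : ℝ) ≤ x) (h2 : x ≤ q + 1) (j : ℤ) :
    tent (x - j) = (if j = q then 1 - (x - q) else 0) + (if j = q + 1 then x - q else 0) := by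
  unfold tent
  rcases lt_trichotomy j q with h | rfl | h
  · rw [if_neg (by omega), if_neg (by omega)]
    have : (j : ℝ) + 1 ≤ q := by exact_mod_cast h
    rw [max_eq_right (by linarith [le_abs_self (x - j)])]
    simp
  · rw [if_pos rfl, if_neg (by omega), abs_of_nonneg (by linarith), max_eq_left (by linarith)]
    simp
  · rcases eq_or_ne j (q + 1) with rfl | h'
    · rw [if_neg (by omega), if_pos rfl]
      push_cast
      rw [abs_of_nonpos (by linarith), max_eq_left (by linarith)]
      ring
    · rw [if_neg (by omega), if_neg h']
      have : (q : ℝ) + 2 ≤ j := by exact_mod_cast (by omega : q + 2 ≤ j)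
      rw [max_eq_right (by linarith [neg_abs_le (x - j)])]
      simp

theorem sum_ite_eq_le {ι β : Type*} [Fintype ι] [DecidableEq β] {g : ι → β}
    (hg : Function.Injective g) (b : β) {A : ℝ} (hA : 0 ≤ A) :
    ∑ i, (if g i = b then A else 0) ≤ A := by
  classical
  by_cases h : ∃ i, g i = b
  · obtain ⟨i, rfl⟩ := h
    simp [hg.eq_iff]
  · push Not at h
    simp [h, hA]

theorem intCast_fin_injective (m : ℕ) :
    Function.Injective fun j : Fin m => ((j : ℕ) : ℤ) := fun a b h => by
  simpa [Fin.ext_iff] using h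

theorem sum_tent_le_one (m : ℕ) (x : ℝ) : ∑ j : Fin m, tent (x - ((j : ℕ) : ℤ)) ≤ 1 := by
  have h1 := Int.floor_le x
  have h2 := (Int.lt_floor_add_one x).le
  simp_rw [tent_sub_int h1 h2, Finset.sum_add_distrib]
  have := sum_ite_eq_le (intCast_fin_injective m) ⌊x⌋ (A := 1 - (x - ⌊x⌋)) (by linarith)
  have := sum_ite_eq_le (intCast_fin_injective m) (⌊x⌋ + 1) (A := x - ⌊x⌋) (by linarith)
  linarith

theorem sum_tent_sub_sq_le_two (m : ℕ) (x y : ℝ) :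
    ∑ j : Fin m, (tent (x - ((j : ℕ) : ℤ)) - tent (y - ((j : ℕ) : ℤ))) ^ 2 ≤ 2 := by
  calc _ ≤ ∑ j : Fin m, (tent (x - ((j : ℕ) : ℤ)) + tent (y - ((j : ℕ) : ℤ))) := by
        refine Finset.sum_le_sum fun j _ => ?_
        have := tent_nonneg (x - ((j : ℕ) : ℤ))
        have := tent_nonneg (y - ((j : ℕ) : ℤ))
        have := tent_le_one (x - ((j : ℕ) : ℤ))
        have := tent_le_one (y - ((j : ℕ) : ℤ))
        nlinarith
    _ ≤ 2 := by
        rw [Finset.sum_add_distrib]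
        linarith [sum_tent_le_one m x, sum_tent_le_one m y]

theorem sum_tent_sub_sq_le {m : ℕ} {x y : ℝ} {q : ℤ} (hx : (q : ℝ) ≤ x) (hx' : x ≤ q + 1)
    (hy : (q : ℝ) ≤ y) (hy' : y ≤ q + 1) :
    ∑ j : Fin m, (tent (x - ((j : ℕ) : ℤ)) - tent (y - ((j : ℕ) : ℤ))) ^ 2 ≤
      2 * (x - y) ^ 2 := by
  have h : ∀ j : ℤ, (tent (x - j) - tent (y - j)) ^ 2 =
      (if j = q then (x - y) ^ 2 else 0) + (if j = q + 1 then (x - y) ^ 2 else 0) := by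
    intro j
    rw [tent_sub_int hx hx', tent_sub_int hy hy']
    rcases eq_or_ne j q with rfl | h
    · simp only [if_true, if_neg (show ¬ j = j + 1 by omega)]
      ring
    · simp only [if_neg h]
      split_ifs <;> ring
  simp_rw [h, Finset.sum_add_distrib]
  have := sum_ite_eq_le (intCast_fin_injective m) q (sq_nonneg (x - y))
  have := sum_ite_eq_le (intCast_fin_injective m) (q + 1) (sq_nonneg (x - y))
  linarith

theorem sum_blurProb_sub_sq_le_two {s : ℕ} (hs : 0 < s) (m d d' : ℕ) :
    ∑ j : Fin m, (blurProb s d j - blurProb s d' j) ^ 2 ≤ 2 := by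
  simp_rw [blurProb_eq_tent hs]
  exact sum_tent_sub_sq_le_two m _ _

/-- With `q = d / s` rounded down, `d` and `d + 1` both lie in the closed cell from `s q` to `s (q +
1)`, where two entries move by `1/s` in opposite directions. -/
theorem sum_blurProb_succ_sub_sq_le {s : ℕ} (hs : 0 < s) (m d : ℕ) :
    ∑ j : Fin m, (blurProb s (d + 1) j - blurProb s d j) ^ 2 ≤ 2 / (s : ℝ) ^ 2 := by
  have hs' : (0 : ℝ) < s := by exact_mod_cast hs
  simp_rw [blurProb_eq_tent hs]
  have h1 : (s : ℝ) * (d / s : ℕ) ≤ d := by exact_mod_cast Nat.mul_div_le d s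
  have h2 : (d : ℝ) + 1 ≤ s * ((d / s : ℕ) + 1) := by
    exact_mod_cast Nat.lt_mul_div_succ d hs
  refine (sum_tent_sub_sq_le (q := ((d / s : ℕ) : ℤ)) ?_ ?_ ?_ ?_).trans (le_of_eq ?_)
  · rw [le_div_iff₀ hs', Int.cast_natCast]; push_cast; linarith
  · rw [div_le_iff₀ hs', Int.cast_natCast]; push_cast; linarith
  · rw [le_div_iff₀ hs', Int.cast_natCast]; linarith
  · rw [div_le_iff₀ hs', Int.cast_natCast]; linarith
  · push_cast
    field_simp
    ring

theorem sum_blurProb_sub_sq_le {s : ℕ} (hs : 0 < s) (m : ℕ) {d d' : ℕ} (h : d ≤ d' + 1)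
    (h' : d' ≤ d + 1) :
    ∑ j : Fin m, (blurProb s d j - blurProb s d' j) ^ 2 ≤ 2 / (s : ℝ) ^ 2 := by
  rcases (by omega : d = d' ∨ d = d' + 1 ∨ d' = d + 1) with rfl | rfl | rfl
  · simp; positivity
  · exact sum_blurProb_succ_sub_sq_le hs m d'
  · simp_rw [sub_sq_comm (blurProb s d _)]
    exact sum_blurProb_succ_sub_sq_le hs m d

theorem NodeNeighbors.symm {n : ℕ} {G G' : SimpleGraph (Fin n)} (h : NodeNeighbors G G') :
    NodeNeighbors G' G :=
  h.imp fun _ hi u v hu hv => (hi u v hu hv).symm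

theorem ncard_neighborSet_le_succ {n : ℕ} {G G' : SimpleGraph (Fin n)} {i : Fin n}
    (h : ∀ u v : Fin n, u ≠ i → v ≠ i → (G.Adj u v ↔ G'.Adj u v)) {u : Fin n} (hu : u ≠ i) :
    (G.neighborSet u).ncard ≤ (G'.neighborSet u).ncard + 1 := by
  refine (Set.ncard_le_ncard (t := insert i (G'.neighborSet u)) ?_ (Set.toFinite _)).trans
    (Set.ncard_insert_le _ _)
  intro v hv
  by_cases hvi : v = i
  · exact Or.inl hvi
  · exact Or.inr ((h u v hu hvi).1 hv)

theorem sum_sum_blurProb_sub_sq_le {n s : ℕ} (hs : 0 < s) (m : ℕ) {G G' : SimpleGraph (Fin n)}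
    (h : NodeNeighbors G G') :
    ∑ i, ∑ j : Fin m, (blurProb s (G.neighborSet i).ncard j -
      blurProb s (G'.neighborSet i).ncard j) ^ 2 ≤ 2 * (1 + (n : ℝ) / (s : ℝ) ^ 2) := by
  obtain ⟨i, hi⟩ := h
  have hb : ∀ u, ∑ j : Fin m, (blurProb s (G.neighborSet u).ncard j -
      blurProb s (G'.neighborSet u).ncard j) ^ 2 ≤
        (if u = i then 2 else 0) + 2 / (s : ℝ) ^ 2 := by
    intro u
    split_ifs with hu
    · have : 0 ≤ 2 / (s : ℝ) ^ 2 := by positivity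
      linarith [sum_blurProb_sub_sq_le_two hs m (G.neighborSet u).ncard
        (G'.neighborSet u).ncard]
    · rw [zero_add]
      exact sum_blurProb_sub_sq_le hs m (ncard_neighborSet_le_succ hi hu)
        (ncard_neighborSet_le_succ (fun a b ha hb => (hi a b ha hb).symm) hu)
  refine (Finset.sum_le_sum fun u _ => hb u).trans (le_of_eq ?_)
  rw [Finset.sum_add_distrib]
  simp
  ring

/-! ### Privacy of the joint reports -/

instance isProbabilityMeasure_blurReport (ε δ : ℝ) (n s : ℕ) (N : Set (Fin n)) :
    IsProbabilityMeasure (blurReport ε δ n s N) := by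
  unfold blurReport; infer_instance

instance isProbabilityMeasure_jointReports (ε δ : ℝ) (n s : ℕ) (G : SimpleGraph (Fin n)) :
    IsProbabilityMeasure (jointReports (fun _ N => blurReport ε δ n s N) G) := by
  unfold jointReports; infer_instance

theorem privacyFactor_sq {ε δ : ℝ} (hδ : 0 < δ) (hδ' : δ ≤ 1 / 2) :
    privacyFactor ε δ ^ 2 = Real.log (1 / δ) / ε ^ 2 := by
  rw [privacyFactor, div_pow, Real.sq_sqrt (Real.log_nonneg _)]
  rw [le_div_iff₀ hδ]; linarith

theorem log_two_le_log_one_div {δ : ℝ} (hδ : 0 < δ) (hδ' : δ ≤ 1 / 2) :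
    Real.log 2 ≤ Real.log (1 / δ) :=
  Real.log_le_log (by norm_num) (by rw [le_div_iff₀ hδ]; linarith)

theorem coe_noiseVariance (ε δ : ℝ) (n s : ℕ) :
    (noiseVariance ε δ n s : ℝ) = 4 * (1 + (n : ℝ) / (s : ℝ) ^ 2) * privacyFactor ε δ ^ 2 :=
  Real.coe_toNNReal _ (by positivity)

theorem noiseVariance_pos {ε δ : ℝ} (n s : ℕ) (hε : 0 < ε) (hδ : 0 < δ) (hδ' : δ ≤ 1 / 2) :
    0 < (noiseVariance ε δ n s : ℝ) := by
  have : 0 < Real.log (1 / δ) :=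
    (Real.log_pos (by norm_num)).trans_le (log_two_le_log_one_div hδ hδ')
  rw [coe_noiseVariance, privacyFactor_sq hδ hδ']
  positivity

theorem jointReports_measure_le {n s : ℕ} (hs : 0 < s) {ε δ : ℝ} (hε : 0 < ε) (hε' : ε ≤ 1)
    (hδ : 0 < δ) (hδ' : δ ≤ 1 / 2) {G G' : SimpleGraph (Fin n)} (h : NodeNeighbors G G')
    {S : Set (Fin n → Fin (numCells n s) → ℝ)} (hS : MeasurableSet S) :
    jointReports (fun _ N => blurReport ε δ n s N) G S ≤
      ENNReal.ofReal (Real.exp ε) * jointReports (fun _ N => blurReport ε δ n s N) G' S +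
        ENNReal.ofReal δ := by
  have hL := log_two_le_log_one_div hδ hδ'
  have hlog2 := Real.log_two_gt_d9
  obtain ⟨L, hLdef⟩ : ∃ L, L = Real.log (1 / δ) := ⟨_, rfl⟩
  rw [← hLdef] at hL
  have hδL : δ = Real.exp (-L) := by
    rw [hLdef, one_div, Real.log_inv, neg_neg, Real.exp_log hδ]
  have hLε : L ≤ L / ε := by rw [le_div_iff₀ hε]; nlinarith
  have hvpos := noiseVariance_pos n s hε hδ hδ'
  have hv : noiseVariance ε δ n s ≠ 0 := by
    intro h0; rw [h0] at hvpos; simp at hvpos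
  -- The shift by `1/2` completes the square: `l (l + 1) = 4 (L/ε)² - 1/4`. The moment exponent is
  -- then at most `L`, while `l ε = 2L - ε/2`.
  obtain ⟨l, hl⟩ : ∃ l, l = 2 * (L / ε) - 1 / 2 := ⟨_, rfl⟩
  have hl0 : 0 < l := by linarith
  have hdens := HasMomentDensity.pi (a := 1 + l) (by linarith)
    (μ := fun i => blurReport ε δ n s (G.neighborSet i))
    (ν := fun i => blurReport ε δ n s (G'.neighborSet i))
    fun i => HasMomentDensity.pi (a := 1 + l) (by linarith) fun j =>
      hasMomentDensity_gaussianReal (1 + l) (blurProb s (G.neighborSet i).ncard j)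
        (blurProb s (G'.neighborSet i).ncard j) hv
  refine hdens.measure_le hl0 ?_ hS
  simp_rw [← Finset.sum_div, ← Finset.mul_sum]
  have hsens := sum_sum_blurProb_sub_sq_le hs (numCells n s) h
  obtain ⟨D, hD⟩ : ∃ D, D = ∑ i, ∑ j : Fin (numCells n s),
    (blurProb s (G.neighborSet i).ncard j - blurProb s (G'.neighborSet i).ncard j) ^ 2 := ⟨_, rfl⟩
  rw [← hD] at hsens ⊢
  have hK : (1 + l) * (1 + l - 1) * D / (2 * (noiseVariance ε δ n s : ℝ)) ≤ L := by
    rw [div_le_iff₀ (by positivity), coe_noiseVariance, privacyFactor_sq hδ hδ', ← hLdef]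
    have h1 : (1 + l) * (1 + l - 1) ≤ 4 * (L / ε) ^ 2 := by rw [hl]; nlinarith
    have h2 : 0 ≤ D := hD ▸ Finset.sum_nonneg fun i _ => Finset.sum_nonneg fun j _ => sq_nonneg _
    calc (1 + l) * (1 + l - 1) * D ≤ 4 * (L / ε) ^ 2 * (2 * (1 + (n : ℝ) / (s : ℝ) ^ 2)) := by
          gcongr
      _ = _ := by field_simp
  calc Real.exp (_ - l * ε) ≤ Real.exp (1 / 2 + -L) := by
        apply Real.exp_le_exp.2
        have : l * ε = 2 * L - ε / 2 := by rw [hl]; field_simp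
        linarith
    _ = Real.exp (1 / 2) * δ := by rw [Real.exp_add, hδL]
    -- The leftover factor is absorbed because `1 + l ≥ 1/2 + 2 log 2 > √e`.
    _ ≤ (1 + l) * δ := by
        gcongr
        have he : Real.exp (1 / 2) ^ 2 = Real.exp 1 := by
          rw [← Real.exp_nat_mul]; norm_num
        have := Real.exp_one_lt_d9
        have := Real.exp_pos (1 / 2)
        nlinarith

/-! ### Measurability of the server -/

theorem measurable_padZero {m : ℕ} (j : ℤ) : Measurable fun v : Fin m → ℝ => padZero v j := by
  unfold padZero
  split_ifs
  · exact measurable_pi_apply _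
  · exact measurable_const
  · exact measurable_const

theorem measurable_sInf_nat {α : Type*} [MeasurableSpace α] {P : α → ℕ → Prop}
    (hP : ∀ k, MeasurableSet {a | P a k}) : Measurable fun a => sInf {k | P a k} := by
  refine measurable_to_countable' fun k => ?_
  -- The second piece covers the default `sInf ∅ = 0`.
  have h : (fun a => sInf {k | P a k}) ⁻¹' {k} =
      ({a | P a k} ∩ ⋂ i ∈ Finset.range k, {a | P a i}ᶜ) ∪
        ({_a | k = 0} ∩ ⋂ i, {a | P a i}ᶜ) := by
    ext a
    simp only [Set.mem_preimage, Set.mem_singleton_iff, Set.mem_union, Set.mem_inter_iff,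
      Set.mem_ofPred_eq, Set.mem_iInter, Finset.mem_range, Set.mem_compl_iff]
    constructor
    · rintro rfl
      by_cases hne : {k | P a k}.Nonempty
      · exact Or.inl ⟨Nat.sInf_mem hne, fun i hi => Nat.notMem_of_lt_sInf hi⟩
      · rw [Set.not_nonempty_iff_eq_empty] at hne
        refine Or.inr ⟨by rw [hne, Nat.sInf_empty], fun i hi => ?_⟩
        have : i ∈ {k | P a k} := hi
        simp [hne] at this
    · rintro (⟨hk, hlt⟩ | ⟨rfl, hne⟩)
      · refine le_antisymm (Nat.sInf_le hk) (le_csInf ⟨k, hk⟩ fun i hi => ?_)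
        by_contra! hik
        exact hlt i hik hi
      · rw [Nat.sInf_eq_zero]
        exact Or.inr (Set.eq_empty_of_forall_notMem hne)
  rw [h]
  refine .union (.inter (hP k) (.biInter (Set.to_countable _) fun i _ => (hP i).compl))
    (.inter (.const _) (.iInter fun i => (hP i).compl))

theorem measurable_argmaxNonzero {m : ℕ} :
    Measurable (argmaxNonzero : (Fin m → ℝ) → ℕ) := by
  refine measurable_sInf_nat fun k => ?_
  refine .inter (.const _) ?_
  have : {v : Fin m → ℝ | ∀ i ∈ Finset.Icc 1 (m - 1), padZero v (i : ℤ) ≤ padZero v (k : ℤ)} =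
      ⋂ i ∈ Finset.Icc 1 (m - 1), {v | padZero v (i : ℤ) ≤ padZero v (k : ℤ)} := by
    ext; simp
  change MeasurableSet {v : Fin m → ℝ | _}
  rw [this]
  exact .biInter (Set.to_countable _) fun i _ =>
    measurableSet_le (measurable_padZero _) (measurable_padZero _)

theorem measurable_selectedIndex (c₁ ε δ : ℝ) (n s : ℕ) :
    Measurable (selectedIndex c₁ ε δ n s) := by
  classical
  -- The entry is read at an index that depends on the vector; joint measurability holds since the
  -- index ranges over a countable set.
  have h : Measurable fun x : (Fin (numCells n s) → ℝ) × ℕ => padZero x.1 (x.2 : ℤ) :=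
    measurable_from_prod_countable_left fun k => measurable_padZero (k : ℤ)
  unfold selectedIndex
  exact .ite (measurableSet_le measurable_const
    (h.comp (measurable_id.prodMk measurable_argmaxNonzero))) measurable_argmaxNonzero
    measurable_const

theorem measurable_concDegServer (c₁ ε δ : ℝ) (n s : ℕ) :
    Measurable (concDegServer c₁ ε δ n s) := by
  have h : Measurable fun x : (Fin (numCells n s) → ℝ) × ℕ =>
      (((s : ℝ) * ((x.2 : ℝ) - 2), ∑ i ∈ Finset.Icc (1 : ℕ) 4,
        (i : ℝ) * (s : ℝ) * padZero x.1 ((x.2 : ℤ) - 2 + (i : ℤ))) : ℝ × ℝ) :=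
    measurable_from_prod_countable_left fun k => by
      dsimp only
      exact measurable_const.prodMk (Finset.measurable_sum _ fun i _ =>
        (measurable_padZero ((k : ℤ) - 2 + (i : ℤ))).const_mul _)
  exact h.comp (measurable_id.prodMk (measurable_selectedIndex c₁ ε δ n s))

/-- The postprocessing of the reports by the estimator of the Erdős–Rényi parameter. -/
noncomputable def erServer (c₁ ε δ : ℝ) (n : ℕ)
    (r : Fin n → Fin (numCells n (erWidth n)) → ℝ) : ℝ :=
  ((concDegServer c₁ ε δ n (erWidth n) fun j => (∑ i, r i j) / (n : ℝ)).1 +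
    (concDegServer c₁ ε δ n (erWidth n) fun j => (∑ i, r i j) / (n : ℝ)).2) / (n : ℝ)

theorem measurable_erServer (c₁ ε δ : ℝ) (n : ℕ) : Measurable (erServer c₁ ε δ n) := by
  have h : Measurable fun (r : Fin n → Fin (numCells n (erWidth n)) → ℝ) =>
      concDegServer c₁ ε δ n (erWidth n) fun j => (∑ i, r i j) / (n : ℝ) :=
    (measurable_concDegServer c₁ ε δ n (erWidth n)).comp (by fun_prop)
  exact (h.fst.add h.snd).div_const _

theorem erEstimator_eq_map (c₁ ε δ : ℝ) (n : ℕ) (G : SimpleGraph (Fin n)) :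
    erEstimator c₁ ε δ n G =
      (jointReports (fun _ N => blurReport ε δ n (erWidth n) N) G).map
        (erServer c₁ ε δ n) := by
  rw [erEstimator, concDeg, blurryPMF,
    Measure.map_map (measurable_concDegServer _ _ _ _ _) (by fun_prop),
    Measure.map_map (by fun_prop)
      ((measurable_concDegServer _ _ _ _ _).comp (by fun_prop))]
  rfl

theorem erWidth_pos {n : ℕ} (hn : 1 ≤ n) : 0 < erWidth n := by
  have h : (1 : ℝ) ≤ n := by exact_mod_cast hn
  have : 0 < Real.log (10 * n) := Real.log_pos (by linarith)
  rw [erWidth, Nat.ceil_pos]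
  positivity

theorem isLNDP_erEstimator (c₁ : ℝ) {n : ℕ} {ε δ : ℝ} (hn : 1 ≤ n) (hε : 0 < ε) (hε' : ε ≤ 1)
    (hδ : 0 < δ) (hδ' : δ ≤ 1 / 2) : IsLNDP ε δ (erEstimator c₁ ε δ n) := by
  refine ⟨Unit, Fin (numCells n (erWidth n)) → ℝ, inferInstance, inferInstance,
    Measure.dirac (), fun _ N => Kernel.const Unit (blurReport ε δ n (erWidth n) N),
    Kernel.deterministic (erServer c₁ ε δ n) (measurable_erServer c₁ ε δ n),
    inferInstance, fun _ _ => inferInstance, inferInstance, fun G => ?_, fun G G' h _ S hS => ?_⟩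
  · simp only [Kernel.const_apply]
    rw [Measure.dirac_bind measurable_const, Measure.deterministic_comp_eq_map,
      erEstimator_eq_map]
  · simp only [Kernel.const_apply]
    exact ⟨jointReports_measure_le (erWidth_pos hn) hε hε' hδ hδ' h hS,
      jointReports_measure_le (erWidth_pos hn) hε hε' hδ hδ' h.symm hS⟩

/-! ### Accuracy of the server for a fixed graph and small noise -/

/-- The blurry degree distribution of the degree sequence `d`. -/
noncomputable def blurryDegree {n : ℕ} (s : ℕ) (d : Fin n → ℕ) (j : ℤ) : ℝ :=
  (∑ i, tent ((d i : ℝ) / s - j)) / n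

theorem tent_pos_iff {x : ℝ} : 0 < tent x ↔ |x| < 1 := by
  simp [tent]

/-- Linear interpolation at the nodes 1, 2, 3, 4 reproduces the identity function between them. -/
theorem sum_tent_window {y : ℝ} (h1 : 1 ≤ y) (h4 : y ≤ 4) :
    ∑ i ∈ Finset.Icc (1 : ℕ) 4, (i : ℝ) * tent (y - i) = y := by
  obtain ⟨q, hq1, hq3, hqy, hyq⟩ : ∃ q : ℤ, 1 ≤ q ∧ q ≤ 3 ∧ (q : ℝ) ≤ y ∧ y ≤ q + 1 := by
    rcases le_total y 2 with h | h
    · exact ⟨1, by norm_num, by norm_num, by push_cast; linarith, by push_cast; linarith⟩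
    · rcases le_total y 3 with h' | h'
      · exact ⟨2, by norm_num, by norm_num, by push_cast; linarith, by push_cast; linarith⟩
      · exact ⟨3, by norm_num, by norm_num, by push_cast; linarith, by push_cast; linarith⟩
  have h : ∀ i : ℕ, tent (y - i) =
      (if (i : ℤ) = q then 1 - (y - q) else 0) + (if (i : ℤ) = q + 1 then y - q else 0) :=
    fun i => by
    rw [← Int.cast_natCast]
    exact tent_sub_int hqy hyq i
  have hI : Finset.Icc (1 : ℕ) 4 = {1, 2, 3, 4} := rfl
  simp_rw [h, hI]
  interval_cases q <;> norm_num
  all_goals ring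

theorem selectedIndex_spec (c₁ ε δ : ℝ) (n s : ℕ) (v : Fin (numCells n s) → ℝ) {τ : ℝ}
    (hτ : τ = c₁ * Real.sqrt (Real.log ((n : ℝ) / (s : ℝ)) / (n : ℝ)) * privacyFactor ε δ) :
    (selectedIndex c₁ ε δ n s v = 0 ∧
        ∀ k ∈ Finset.Icc 1 (numCells n s - 1), padZero v (k : ℤ) < τ) ∨
      (selectedIndex c₁ ε δ n s v ∈ Finset.Icc 1 (numCells n s - 1) ∧
        τ ≤ padZero v (selectedIndex c₁ ε δ n s v : ℤ) ∧
        ∀ k ∈ Finset.Icc 1 (numCells n s - 1),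
          padZero v (k : ℤ) ≤ padZero v (selectedIndex c₁ ε δ n s v : ℤ)) := by
  by_cases hne : (Finset.Icc 1 (numCells n s - 1)).Nonempty
  · obtain ⟨j, hj, hmax⟩ := Finset.exists_max_image _ (fun k : ℕ => padZero v (k : ℤ)) hne
    have hmem : argmaxNonzero v ∈ {j : ℕ | j ∈ Finset.Icc 1 (numCells n s - 1) ∧
        ∀ k ∈ Finset.Icc 1 (numCells n s - 1), padZero v (k : ℤ) ≤ padZero v (j : ℤ)} :=
      Nat.sInf_mem ⟨j, hj, hmax⟩
    unfold selectedIndex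
    rw [← hτ]
    split_ifs with h
    · exact Or.inr ⟨hmem.1, h, hmem.2⟩
    · exact Or.inl ⟨rfl, fun k hk => (hmem.2 k hk).trans_lt (not_le.1 h)⟩
  · rw [Finset.not_nonempty_iff_eq_empty] at hne
    refine Or.inl ⟨?_, by simp [hne]⟩
    have h0 : argmaxNonzero v = 0 := by
      unfold argmaxNonzero
      simp [hne]
    unfold selectedIndex
    split_ifs
    · exact h0
    · rfl

theorem div_le_numCells_sub_one {n s d : ℕ} (hd : d ≤ n) :
    (d : ℝ) / s ≤ (numCells n s - 1 : ℕ) := by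
  rw [numCells, Nat.add_sub_cancel]
  refine le_trans ?_ (Nat.le_ceil _)
  have : (d : ℝ) ≤ n := by exact_mod_cast hd
  gcongr

/-- The last cell is at `⌈n/s⌉`, beyond every `d i / s`, so no mass is lost and padding by zero is
exact. -/
theorem blurryDegree_eq_zero {n s : ℕ} {d : Fin n → ℕ} (hd : ∀ i, d i < n) (hs : 0 < s) {j : ℤ}
    (hj : j < 0 ∨ (numCells n s : ℤ) ≤ j) : blurryDegree s d j = 0 := by
  unfold blurryDegree
  rw [Finset.sum_eq_zero, zero_div]
  intro i _
  refine le_antisymm (not_lt.1 fun h => ?_) (tent_nonneg _)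
  rw [tent_pos_iff, abs_lt] at h
  have h0 : (0 : ℝ) ≤ (d i : ℝ) / s := by positivity
  have h1 := div_le_numCells_sub_one (s := s) (hd i).le
  rcases hj with hj | hj
  · have : (j : ℝ) + 1 ≤ 0 := by exact_mod_cast hj
    linarith
  · have h2 : ((numCells n s : ℤ) : ℝ) ≤ j := by exact_mod_cast hj
    have h3 : ((numCells n s : ℤ) : ℝ) = (numCells n s - 1 : ℕ) + 1 := by
      have : 1 ≤ numCells n s := by unfold numCells; omega
      rw [Nat.cast_sub this]; push_cast; ring
    linarith

theorem padZero_of_out_of_range {m : ℕ} (v : Fin m → ℝ) {j : ℤ} (hj : j < 0 ∨ (m : ℤ) ≤ j) :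
    padZero v j = 0 := by
  unfold padZero
  split_ifs with h1 h2
  · omega
  · rfl
  · rfl

theorem le_avg {n : ℕ} (hn : 1 ≤ n) {f : Fin n → ℝ} {a : ℝ} (h : ∀ i, a ≤ f i) :
    a ≤ (∑ i, f i) / n := by
  have hn' : (0 : ℝ) < n := by exact_mod_cast hn
  rw [le_div_iff₀ hn']
  calc a * n = ∑ _i : Fin n, a := by simp [mul_comm]
    _ ≤ _ := Finset.sum_le_sum fun i _ => h i

/-- If no entry reaches the threshold, the degrees must be small, since otherwise the grid point
nearest `X` would carry visible mass. If `J` is selected, some degree is within one cell of `J`,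
hence all are within `1 + 12/25`. A degree below `J - 1` is excluded because `J - 1` would then beat
`J`. -/
theorem selectedIndex_window {c₁ ε δ : ℝ} {n s : ℕ} (hn : 1 ≤ n) (hs : 0 < s) {d : Fin n → ℕ}
    (hd : ∀ i, d i < n) {X τ : ℝ}
    (hX : ∀ i, |(d i : ℝ) / s - X| ≤ 6 / 25) (v : Fin (numCells n s) → ℝ)
    (hτ : τ = c₁ * Real.sqrt (Real.log ((n : ℝ) / (s : ℝ)) / (n : ℝ)) * privacyFactor ε δ)
    (hτ0 : 0 < τ) (hτ1 : τ ≤ 1 / 50)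
    (hW : ∀ j : ℤ, |padZero v j - blurryDegree s d j| ≤ τ / 2) (i : Fin n) :
    (selectedIndex c₁ ε δ n s v : ℝ) - 1 ≤ (d i : ℝ) / s ∧
      (d i : ℝ) / s ≤ (selectedIndex c₁ ε δ n s v : ℝ) + 2 := by
  have hx0 : ∀ l, (0 : ℝ) ≤ (d l : ℝ) / s := fun l => by positivity
  have hn' : (0 : ℝ) < n := by exact_mod_cast hn
  have hpair : ∀ l k, |(d l : ℝ) / s - (d k : ℝ) / s| ≤ 12 / 25 := by
    intro l k
    have := abs_le.1 (hX l)
    have := abs_le.1 (hX k)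
    rw [abs_le]
    constructor <;> linarith
  rcases selectedIndex_spec c₁ ε δ n s v hτ with ⟨h0, hlt⟩ | ⟨hJ, hτJ, hmax⟩
  · rw [h0]
    refine ⟨by simpa using (show (-1 : ℝ) ≤ _ by linarith [hx0 i]), ?_⟩
    by_contra! hgt
    simp only [Nat.cast_zero, zero_add] at hgt
    have hr := abs_le.1 (abs_sub_round X)
    have hXi := abs_le.1 (hX i)
    have hr1 : 1 ≤ round X := by
      have : (1 : ℝ) < round X := by linarith
      exact_mod_cast this.le
    -- Rounding costs at most `1/2` and the spread `6/25`, leaving `1 - 37/50` at every node.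
    have hv : 13 / 50 ≤ blurryDegree s d (round X) := by
      refine le_avg hn fun l => ?_
      have := abs_le.1 (hX l)
      have : |(d l : ℝ) / s - round X| ≤ 37 / 50 := abs_le.2 ⟨by linarith, by linarith⟩
      exact le_trans (by linarith) (le_max_left _ _)
    have hrange : round X < numCells n s := by
      by_contra! h
      rw [blurryDegree_eq_zero hd hs (Or.inr h)] at hv
      norm_num at hv
    obtain ⟨k, hk⟩ := Int.eq_ofNat_of_zero_le (by omega : 0 ≤ round X)
    rw [hk] at hr1 hrange hv
    have := hlt k (Finset.mem_Icc.2 ⟨by omega, by omega⟩)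
    have := abs_le.1 (hW k)
    linarith
  · obtain ⟨J, hJdef⟩ : ∃ J, J = selectedIndex c₁ ε δ n s v := ⟨_, rfl⟩
    rw [← hJdef] at hJ hτJ hmax ⊢
    obtain ⟨hJ1, hJm⟩ := Finset.mem_Icc.1 hJ
    have hWJ := abs_le.1 (hW J)
    have hpos : 0 < blurryDegree s d J := by linarith
    obtain ⟨l, hl⟩ : ∃ l, 0 < tent ((d l : ℝ) / s - (J : ℤ)) := by
      by_contra! h
      have : blurryDegree s d J ≤ 0 :=
        div_nonpos_of_nonpos_of_nonneg (Finset.sum_nonpos fun l _ => h l) hn'.le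
      linarith
    rw [tent_pos_iff, abs_lt, Int.cast_natCast] at hl
    have hil := abs_le.1 (hpair i l)
    refine ⟨?_, by linarith⟩
    by_contra! hlow
    -- The competitor `J - 1` must be a candidate of the argmax, which skips index 0. For `J = 1`
    -- the assumed degree would be negative.
    have hJ2 : 2 ≤ J := by
      by_contra! h
      have : J = 1 := by omega
      subst this
      norm_num at hlow
      linarith [hx0 i]
    have hWJ' := abs_le.1 (hW ((J - 1 : ℕ) : ℤ))
    have hm := hmax (J - 1) (Finset.mem_Icc.2 ⟨by omega, by omega⟩)
    -- Node `i` lies below `J - 1` and node `l` above it, so all nodes are within `12/25` of `J -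
    -- 1`; the gap is at least `1 - 2 · 12/25`. Noise can close it by at most `τ ≤ 1/50`.
    have hgap : 1 / 25 ≤ blurryDegree s d ((J - 1 : ℕ) : ℤ) - blurryDegree s d J := by
      unfold blurryDegree
      rw [← sub_div, ← Finset.sum_sub_distrib]
      refine le_avg hn fun k => ?_
      have hki := abs_le.1 (hpair k i)
      have hkl := abs_le.1 (hpair k l)
      have h1 : 1 - |(d k : ℝ) / s - ((J - 1 : ℕ) : ℤ)| ≤
        tent ((d k : ℝ) / s - ((J - 1 : ℕ) : ℤ)) := le_max_left _ _
      have hc : (((J - 1 : ℕ) : ℤ) : ℝ) = J - 1 := by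
        rw [Int.cast_natCast, Nat.cast_sub (by omega), Nat.cast_one]
      have h2 : tent ((d k : ℝ) / s - (J : ℤ)) ≤ max ((d k : ℝ) / s - (J - 1)) 0 := by
        unfold tent
        refine max_le_max ?_ le_rfl
        rw [Int.cast_natCast]
        linarith [neg_abs_le ((d k : ℝ) / s - J)]
      rw [hc] at h1 ⊢
      rcases le_total ((d k : ℝ) / s - (J - 1)) 0 with h | h
      · rw [max_eq_right h] at h2
        rw [abs_of_nonpos h] at h1
        linarith
      · rw [max_eq_left h] at h2
        rw [abs_of_nonneg h] at h1
        linarith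
    linarith

/-- The server is exact on the noiseless blurry distribution, so only noise at the four window
entries remains, with weights `1 + 2 + 3 + 4 = 10`. These entries are within `3 + 6/25 < 4` of `X`,
so the local bound `η` applies to them. -/
theorem abs_concDegServer_sub_le {c₁ ε δ : ℝ} {n s : ℕ} (hn : 1 ≤ n) (hs : 0 < s)
    {d : Fin n → ℕ} (hd : ∀ i, d i < n) {X τ η : ℝ}
    (hX : ∀ i, |(d i : ℝ) / s - X| ≤ 6 / 25) (v : Fin (numCells n s) → ℝ)
    (hτ : τ = c₁ * Real.sqrt (Real.log ((n : ℝ) / (s : ℝ)) / (n : ℝ)) * privacyFactor ε δ)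
    (hτ0 : 0 < τ) (hτ1 : τ ≤ 1 / 50)
    (hW : ∀ j : ℤ, |padZero v j - blurryDegree s d j| ≤ τ / 2)
    (hη : ∀ j : ℤ, |(j : ℝ) - X| < 4 → |padZero v j - blurryDegree s d j| ≤ η) :
    |(concDegServer c₁ ε δ n s v).1 + (concDegServer c₁ ε δ n s v).2 -
      (∑ i, (d i : ℝ)) / n| ≤ 10 * s * η := by
  have hn' : (0 : ℝ) < n := by exact_mod_cast hn
  have hs' : (0 : ℝ) < s := by exact_mod_cast hs
  have hwin := selectedIndex_window hn hs hd hX v hτ hτ0 hτ1 hW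
  unfold concDegServer
  obtain ⟨J, hJ⟩ : ∃ J, J = selectedIndex c₁ ε δ n s v := ⟨_, rfl⟩
  rw [← hJ] at hwin ⊢
  dsimp only
  have hexact : (s : ℝ) * ((J : ℝ) - 2) + ∑ k ∈ Finset.Icc (1 : ℕ) 4,
      (k : ℝ) * (s : ℝ) * blurryDegree s d ((J : ℤ) - 2 + (k : ℤ)) = (∑ i, (d i : ℝ)) / n := by
    have hterm : ∀ i, ∑ k ∈ Finset.Icc (1 : ℕ) 4,
        (k : ℝ) * tent ((d i : ℝ) / s - ((J : ℤ) - 2 + (k : ℤ) : ℤ)) =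
          (d i : ℝ) / s - (J - 2) := by
      intro i
      have h := (sum_tent_window (y := (d i : ℝ) / s - (J - 2)) (by linarith [(hwin i).1])
        (by linarith [(hwin i).2]))
      rw [← h]
      refine Finset.sum_congr rfl fun k _ => ?_
      congr 2
      push_cast
      ring
    have : ∑ k ∈ Finset.Icc (1 : ℕ) 4,
        (k : ℝ) * (s : ℝ) * blurryDegree s d ((J : ℤ) - 2 + (k : ℤ)) =
          s * ((∑ i, ((d i : ℝ) / s - (J - 2))) / n) := by
      simp_rw [← hterm, blurryDegree]
      rw [Finset.sum_comm, Finset.sum_div, Finset.mul_sum]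
      refine Finset.sum_congr rfl fun k _ => ?_
      rw [← Finset.mul_sum]
      ring
    rw [this, Finset.sum_sub_distrib, ← Finset.sum_div]
    simp only [Finset.sum_const, Finset.card_univ, Fintype.card_fin, nsmul_eq_mul]
    field_simp
    ring
  have hdiff : (s : ℝ) * ((J : ℝ) - 2) + ∑ k ∈ Finset.Icc (1 : ℕ) 4,
      (k : ℝ) * (s : ℝ) * padZero v ((J : ℤ) - 2 + (k : ℤ)) - (∑ i, (d i : ℝ)) / n =
        ∑ k ∈ Finset.Icc (1 : ℕ) 4, (k : ℝ) * (s : ℝ) * (padZero v ((J : ℤ) - 2 + (k : ℤ)) -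
          blurryDegree s d ((J : ℤ) - 2 + (k : ℤ))) := by
    rw [← hexact]
    simp_rw [mul_sub, Finset.sum_sub_distrib]
    ring
  rw [hdiff]
  refine (Finset.abs_sum_le_sum_abs _ _).trans ?_
  calc _ ≤ ∑ k ∈ Finset.Icc (1 : ℕ) 4, (k : ℝ) * (s : ℝ) * η := by
        refine Finset.sum_le_sum fun k hk => ?_
        rw [abs_mul, abs_of_nonneg (by positivity)]
        refine mul_le_mul_of_nonneg_left (hη _ ?_) (by positivity)
        obtain ⟨hk1, hk4⟩ := Finset.mem_Icc.1 hk
        have hk1' : (1 : ℝ) ≤ k := by exact_mod_cast hk1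
        have hk4' : (k : ℝ) ≤ 4 := by exact_mod_cast hk4
        have hi := hwin ⟨0, hn⟩
        have hXi := abs_le.1 (hX ⟨0, hn⟩)
        push_cast
        rw [abs_lt]
        constructor <;> linarith
    _ = 10 * s * η := by
        have hI : Finset.Icc (1 : ℕ) 4 = {1, 2, 3, 4} := rfl
        rw [hI]
        norm_num
        ring

/-! ### Tail bounds -/

theorem measureReal_abs_ge_le {Ω : Type*} [MeasurableSpace Ω] {μ : Measure Ω} {X : Ω → ℝ}
    {c : NNReal} (h : HasSubgaussianMGF X c μ) {t : ℝ} (ht : 0 ≤ t) :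
    μ.real {ω | t ≤ |X ω|} ≤ 2 * Real.exp (-t ^ 2 / (2 * c)) := by
  have : IsFiniteMeasure μ := by
    have := h.integrable_exp_mul 0
    simp only [zero_mul, Real.exp_zero] at this
    exact (integrable_const_iff_isFiniteMeasure one_ne_zero).1 this
  have hsub : {ω | t ≤ |X ω|} ⊆ {ω | t ≤ X ω} ∪ {ω | t ≤ (-X) ω} := fun ω hω => by
    simpa [le_abs] using hω
  calc μ.real {ω | t ≤ |X ω|} ≤ μ.real {ω | t ≤ X ω} + μ.real {ω | t ≤ (-X) ω} :=
        (measureReal_mono hsub).trans (measureReal_union_le _ _)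
    _ ≤ _ := by linarith [h.measure_ge_le ht, h.neg.measure_ge_le ht]

theorem hasSubgaussianMGF_gaussianReal (v : NNReal) :
    HasSubgaussianMGF (fun x : ℝ => x) v (gaussianReal 0 v) where
  integrable_exp_mul t := integrable_exp_mul_gaussianReal t
  mgf_le t := by rw [mgf_fun_id_gaussianReal]; simp

theorem hasSubgaussianMGF_noise {n m : ℕ} {v : NNReal} (b : Fin n → Fin m → ℝ) (j : Fin m) :
    HasSubgaussianMGF (fun r : Fin n → Fin m → ℝ => ∑ i, (r i j - b i j)) (n * v)
      (Measure.pi fun i => Measure.pi fun k => gaussianReal (b i k) v) := by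
  have hind : iIndepFun (fun i (r : Fin n → Fin m → ℝ) => r i j - b i j)
      (Measure.pi fun i => Measure.pi fun k => gaussianReal (b i k) v) :=
    iIndepFun_pi (X := fun i (x : Fin m → ℝ) => x j - b i j)
      fun i => Measurable.aemeasurable (by fun_prop)
  have h := HasSubgaussianMGF.sum_of_iIndepFun hind (c := fun _ => v) (s := Finset.univ)
    fun i _ => by
      have hmp : (Measure.pi fun i => Measure.pi fun k => gaussianReal (b i k) v).map
          (fun r : Fin n → Fin m → ℝ => r i j - b i j) = gaussianReal 0 v := by
        have h1 := (measurePreserving_eval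
          (fun i => Measure.pi fun k => gaussianReal (b i k) v) i).map_eq
        have h2 := (measurePreserving_eval (fun k => gaussianReal (b i k) v) j).map_eq
        have h3 := gaussianReal_map_sub_const (μ := b i j) (v := v) (b i j)
        rw [sub_self] at h3
        rw [← h3, ← h2, ← h1, Measure.map_map (by fun_prop) (by fun_prop),
          Measure.map_map (by fun_prop) (by fun_prop)]
        rfl
      exact HasSubgaussianMGF.of_map (X := fun x : ℝ => x)
        (Y := fun r : Fin n → Fin m → ℝ => r i j - b i j) (Measurable.aemeasurable (by fun_prop))
        (hmp ▸ hasSubgaussianMGF_gaussianReal v)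
  simpa using h

/-- The error of the estimated blurry degree distribution at index `j`. -/
noncomputable def blurError {n : ℕ} (s : ℕ) (G : SimpleGraph (Fin n)) (j : ℤ)
    (r : Fin n → Fin (numCells n s) → ℝ) : ℝ :=
  padZero (fun k => (∑ i, r i k) / (n : ℝ)) j -
    blurryDegree s (fun i => (G.neighborSet i).ncard) j

theorem ncard_neighborSet_lt {n : ℕ} (G : SimpleGraph (Fin n)) (i : Fin n) :
    (G.neighborSet i).ncard < n := by
  have h := Set.ncard_lt_card (s := G.neighborSet i)
    (fun h => G.irrefl (show G.Adj i i from (h ▸ Set.mem_univ i : i ∈ G.neighborSet i)))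
  simpa using h

theorem measureReal_blurError_le {n s : ℕ} (hn : 1 ≤ n) (hs : 0 < s) (ε δ : ℝ)
    (G : SimpleGraph (Fin n)) (j : ℤ) {t : ℝ} (ht : 0 < t) :
    (jointReports (fun _ N => blurReport ε δ n s N) G).real {r | t ≤ |blurError s G j r|} ≤
      2 * Real.exp (-(t ^ 2 * n / (2 * noiseVariance ε δ n s))) := by
  have hn' : (0 : ℝ) < n := by exact_mod_cast hn
  by_cases hj : j < 0 ∨ (numCells n s : ℤ) ≤ j
  · have : {r | t ≤ |blurError s G j r|} = ∅ := by
      refine Set.eq_empty_of_forall_notMem fun r (hr : t ≤ |blurError s G j r|) => ?_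
      rw [blurError, padZero_of_out_of_range _ hj,
        blurryDegree_eq_zero (ncard_neighborSet_lt G) hs hj] at hr
      simp only [sub_zero, abs_zero] at hr
      linarith
    rw [this, measureReal_empty]
    positivity
  · push Not at hj
    obtain ⟨k, rfl⟩ := Int.eq_ofNat_of_zero_le hj.1
    have hk : k < numCells n s := by exact_mod_cast hj.2
    have herr : ∀ r, blurError s G k r =
        (∑ i, (r i ⟨k, hk⟩ - blurProb s (G.neighborSet i).ncard k)) / n := by
      intro r
      unfold blurError padZero blurryDegree
      simp only [Int.toNat_natCast, hk, dite_true, Int.natCast_nonneg, if_true,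
        blurProb_eq_tent hs]
      rw [Finset.sum_sub_distrib, sub_div]
    have h := measureReal_abs_ge_le (hasSubgaussianMGF_noise (v := noiseVariance ε δ n s)
      (fun (i : Fin n) (k : Fin (numCells n s)) => blurProb s (G.neighborSet i).ncard k) ⟨k, hk⟩)
      (t := t * n) (by positivity)
    have hset : {r | t ≤ |blurError s G k r|} = {r | t * n ≤
        |∑ i, (r i ⟨k, hk⟩ - blurProb s (G.neighborSet i).ncard k)|} := by
      ext r
      simp only [Set.mem_ofPred_eq, herr, abs_div, abs_of_pos hn', le_div_iff₀ hn']
    rw [hset]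
    refine h.trans (le_of_eq ?_)
    congr 2
    push_cast
    rw [neg_div]
    congr 1
    rcases eq_or_ne (noiseVariance ε δ n s : ℝ) 0 with h0 | h0
    · simp [h0]
    · field_simp

open Classical in
/-- The indicator of an edge. -/
noncomputable def edgeIndicator (e : Prop) : ℝ := if e then 1 else 0

/-- The law of the indicator of a single potential edge. -/
noncomputable def edgeLaw {V : Type*} (p : unitInterval) (e : Sym2 V) : Measure Prop :=
  unitInterval.toNNReal p • Measure.dirac (e ∈ (Sym2.diagSetᶜ : Set (Sym2 V))) +
    unitInterval.toNNReal (unitInterval.symm p) • Measure.dirac False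

instance {V : Type*} (p : unitInterval) (e : Sym2 V) : IsProbabilityMeasure (edgeLaw p e) := by
  unfold edgeLaw; infer_instance

theorem measurable_edgeIndicator : Measurable edgeIndicator := .of_discrete

theorem integral_edgeIndicator {V : Type*} (p : unitInterval) {e : Sym2 V} (he : ¬ e.IsDiag) :
    ∫ x, edgeIndicator x ∂(edgeLaw p e) = p := by
  have hi : ∀ q : Prop, Integrable edgeIndicator (Measure.dirac q) := fun q =>
    integrable_dirac (by simp [enorm_lt_top])
  unfold edgeLaw
  rw [integral_add_measure ((hi _).smul_measure_nnreal) ((hi _).smul_measure_nnreal),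
    integral_smul_nnreal_measure, integral_smul_nnreal_measure, integral_dirac, integral_dirac]
  simp [edgeIndicator, he, NNReal.smul_def]

/-- Exposes the edges as independent coordinates, so that Hoeffding's inequality applies to edge
counts. -/
theorem binomialRandom_eq_map_infinitePi {V : Type*} [Countable V] (p : unitInterval) :
    SimpleGraph.binomialRandom V p = (Measure.infinitePi (edgeLaw (V := V) p)).map
      fun ω => SimpleGraph.fromEdgeSet {e | ω e} := by
  have hm : Measurable fun q : Sym2 V → Prop => {e | q e} := MeasurableEquiv.setOfPred.measurable
  rw [SimpleGraph.binomialRandom_eq_map, setBernoulli_eq_map,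
    Measure.map_map SimpleGraph.measurable_fromEdgeSet hm]
  rfl

theorem measureReal_sum_edgeIndicator_le {V : Type*} (p : unitInterval) (F : Finset (Sym2 V))
    (hF : ∀ e ∈ F, ¬ e.IsDiag) {t : ℝ} (ht : 0 ≤ t) :
    (Measure.infinitePi (edgeLaw (V := V) p)).real
      {ω | t ≤ |∑ e ∈ F, edgeIndicator (ω e) - p * F.card|} ≤
        2 * Real.exp (-(2 * t ^ 2 / F.card)) := by
  have hind : iIndepFun (fun e (ω : Sym2 V → Prop) => edgeIndicator (ω e) - p)
      (Measure.infinitePi (edgeLaw (V := V) p)) :=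
    iIndepFun_infinitePi (X := fun _ q => edgeIndicator q - p)
      fun e => measurable_edgeIndicator.sub_const _
  have h := HasSubgaussianMGF.sum_of_iIndepFun hind (c := fun _ => (‖(1 : ℝ) - 0‖₊ / 2) ^ 2)
    (s := F) fun e he => by
      have h1 := hasSubgaussianMGF_of_mem_Icc (μ := edgeLaw p e) (X := edgeIndicator)
        (a := 0) (b := 1) measurable_edgeIndicator.aemeasurable
        (ae_of_all _ fun q => by unfold edgeIndicator; split_ifs <;> simp)
      rw [integral_edgeIndicator p (hF e he),
        ← (measurePreserving_eval_infinitePi (edgeLaw p) e).map_eq] at h1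
      exact HasSubgaussianMGF.of_map 
        (measurePreserving_eval_infinitePi (edgeLaw p) e).measurable.aemeasurable h1
  have h2 := measureReal_abs_ge_le h ht
  have hset : {ω : Sym2 V → Prop | t ≤ |∑ e ∈ F, edgeIndicator (ω e) - p * F.card|} =
      {ω | t ≤ |∑ e ∈ F, (edgeIndicator (ω e) - p)|} := by
    ext ω
    simp [Finset.sum_sub_distrib, mul_comm]
  rw [hset]
  refine h2.trans (le_of_eq ?_)
  congr 2
  simp
  field_simp

/-! ### Degrees of binomial random graphs -/

theorem ofReal_one_sub_le_measure {Ω : Type*} [MeasurableSpace Ω] {μ : Measure Ω}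
    [IsProbabilityMeasure μ] {A B : Set Ω} {b : ℝ} (h : ∀ x, x ∉ B → x ∈ A) (hB : μ.real B ≤ b) :
    ENNReal.ofReal (1 - b) ≤ μ A := by
  have h1 : (1 : ℝ) ≤ μ.real A + μ.real B := by
    rw [← probReal_univ (μ := μ)]
    exact (measureReal_mono fun x _ => or_iff_not_imp_right.2 (h x)).trans
      (measureReal_union_le A B)
  rw [← ofReal_measureReal]
  exact ENNReal.ofReal_le_ofReal (by linarith)

theorem ncard_neighborSet_fromEdgeSet {n : ℕ} (ω : Sym2 (Fin n) → Prop) (i : Fin n) :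
    (((SimpleGraph.fromEdgeSet {e | ω e}).neighborSet i).ncard : ℝ) =
      ∑ e ∈ (Finset.univ.erase i).image fun j => s(i, j), edgeIndicator (ω e) := by
  classical
  rw [Finset.sum_image fun a _ b _ h => Sym2.congr_right.1 h]
  have h : (SimpleGraph.fromEdgeSet {e | ω e}).neighborSet i =
      (((Finset.univ.erase i).filter fun j => ω s(i, j) : Finset (Fin n)) : Set (Fin n)) := by
    ext j
    simp [and_comm, eq_comm]
  rw [h, Set.ncard_coe_finset, Finset.card_filter]
  push_cast
  exact Finset.sum_congr rfl fun j _ => by unfold edgeIndicator; congr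

theorem sum_ncard_neighborSet_fromEdgeSet {n : ℕ} (ω : Sym2 (Fin n) → Prop) :
    ∑ i, (((SimpleGraph.fromEdgeSet {e | ω e}).neighborSet i).ncard : ℝ) =
      2 * ∑ e : Sym2 (Fin n) with ¬ e.IsDiag, edgeIndicator (ω e) := by
  classical
  obtain ⟨G, hG⟩ : ∃ G, G = SimpleGraph.fromEdgeSet {e | ω e} := ⟨_, rfl⟩
  rw [← hG]
  have h := G.sum_degrees_eq_twice_card_edges
  have hdeg : ∀ i, (G.neighborSet i).ncard = G.degree i := fun i => by
    rw [Set.ncard_eq_toFinset_card']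
    rfl
  simp_rw [hdeg]
  have hE : G.edgeFinset =
      (Finset.univ.filter fun e : Sym2 (Fin n) => ¬ e.IsDiag).filter fun e => ω e := by
    ext e
    rw [SimpleGraph.mem_edgeFinset, hG]
    simp [and_comm]
  rw [hE, Finset.card_filter] at h
  have h' := congrArg (Nat.cast : ℕ → ℝ) h
  push_cast at h'
  rw [h']
  congr 1

theorem card_image_erase {n : ℕ} (i : Fin n) :
    (((Finset.univ.erase i).image fun j => s(i, j)).card : ℝ) = n - 1 := by
  rw [Finset.card_image_of_injective _ fun a b h => Sym2.congr_right.1 h,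
    Finset.card_erase_of_mem (Finset.mem_univ i), Finset.card_univ, Fintype.card_fin,
    Nat.cast_sub (by have := i.pos; omega), Nat.cast_one]

theorem card_filter_not_isDiag (n : ℕ) :
    ((Finset.univ.filter fun e : Sym2 (Fin n) => ¬ e.IsDiag).card : ℝ) = n * (n - 1) / 2 := by
  rw [← Fintype.card_subtype, Sym2.card_subtype_not_diag, Fintype.card_fin, Nat.cast_choose_two]

theorem twelve_mul_le_erWidth_sq {n : ℕ} (hn : 1 ≤ n) :
    12 * n * Real.log (10 * n) ≤ (erWidth n : ℝ) ^ 2 := by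
  have h1 : (1 : ℝ) ≤ n := by exact_mod_cast hn
  have hlog : 0 ≤ Real.log (10 * n) := Real.log_nonneg (by linarith)
  have h : 2 * Real.sqrt (3 * n * Real.log (10 * n)) ≤ erWidth n := Nat.le_ceil _
  calc 12 * n * Real.log (10 * n) = (2 * Real.sqrt (3 * n * Real.log (10 * n))) ^ 2 := by
        rw [mul_pow, Real.sq_sqrt (by positivity)]; ring
    _ ≤ _ := by gcongr

/-- All degrees are close to `p (n - 1)`, and their average is even closer to this value. -/
def ConcentratedDegrees {n : ℕ} (p : ℝ) (d : Fin n → ℕ) : Prop :=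
  (∀ i, |(d i : ℝ) - p * (n - 1)| ≤ 6 / 25 * erWidth n) ∧
    |∑ i, (d i : ℝ) - p * (n * (n - 1))| ≤ 2 * n

/-- Hoeffding is applied to the `n - 1` pairs at each node and separately to all pairs; the failures
sum to `n · 2/(10n) + 1/20 = 1/4`. The average degree needs its own bound, as the individual ones
only give order `s`. -/
theorem measureReal_not_concentratedDegrees_le {n : ℕ} (hn : 2 ≤ n) (p : unitInterval) :
    (Measure.infinitePi (edgeLaw (V := Fin n) p)).real
      {ω | ¬ ConcentratedDegrees (p : ℝ)
        fun i => ((SimpleGraph.fromEdgeSet {e | ω e}).neighborSet i).ncard} ≤ 1 / 4 := by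
  have hn' : (2 : ℝ) ≤ n := by exact_mod_cast hn
  obtain ⟨μ, hμ⟩ : ∃ μ, μ = Measure.infinitePi (edgeLaw (V := Fin n) p) := ⟨_, rfl⟩
  have : IsProbabilityMeasure μ := hμ ▸ inferInstance
  rw [← hμ]
  let F : Fin n → Finset (Sym2 (Fin n)) := fun i => (Finset.univ.erase i).image fun j => s(i, j)
  let E : Finset (Sym2 (Fin n)) := Finset.univ.filter fun e => ¬ e.IsDiag
  have hF : ∀ i, μ.real {ω | 6 / 25 * (erWidth n : ℝ) ≤
      |∑ e ∈ F i, edgeIndicator (ω e) - p * (F i).card|} ≤ 2 / (10 * n) := by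
    intro i
    have h := measureReal_sum_edgeIndicator_le p (F i) (fun e he => by
      obtain ⟨j, hj, rfl⟩ := Finset.mem_image.1 he
      simpa [eq_comm] using Finset.ne_of_mem_erase hj) (t := 6 / 25 * (erWidth n : ℝ))
      (by positivity)
    rw [← hμ] at h
    refine h.trans ?_
    -- The width satisfies `s² ≥ 12 n log(10n)`, and `2 · (6/25)² · 12 > 1`.
    have hexp : Real.log (10 * n) ≤ 2 * (6 / 25 * (erWidth n : ℝ)) ^ 2 / (F i).card := by
      rw [card_image_erase, le_div_iff₀ (by linarith)]
      have h1 := twelve_mul_le_erWidth_sq (by omega : 1 ≤ n)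
      have h2 : 0 ≤ Real.log (10 * n) := Real.log_nonneg (by linarith)
      have h3 : 0 ≤ n * Real.log (10 * n) := by positivity
      nlinarith
    calc _ ≤ 2 * Real.exp (-Real.log (10 * n)) := by gcongr
      _ = 2 / (10 * n) := by
        rw [Real.exp_neg, Real.exp_log (by linarith), div_eq_mul_inv]
  have hE : μ.real {ω | (n : ℝ) ≤ |∑ e ∈ E, edgeIndicator (ω e) - p * E.card|} ≤ 1 / 20 := by
    have h := measureReal_sum_edgeIndicator_le p E (fun e he => (Finset.mem_filter.1 he).2)
      (t := (n : ℝ)) (by positivity)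
    rw [← hμ] at h
    refine h.trans ?_
    have hexp : 4 ≤ 2 * (n : ℝ) ^ 2 / E.card := by
      rw [card_filter_not_isDiag, le_div_iff₀ (by nlinarith)]
      nlinarith
    calc _ ≤ 2 * Real.exp (-(4 : ℕ)) := by push_cast; gcongr
      _ ≤ 1 / 20 := by
        rw [Real.exp_neg, ← Real.exp_one_pow, ← div_eq_mul_inv,
          div_le_iff₀ (by positivity)]
        have : (2.7 : ℝ) ^ 4 ≤ Real.exp 1 ^ 4 := by
          gcongr; linarith [Real.exp_one_gt_d9]
        have : (40 : ℝ) ≤ 2.7 ^ 4 := by norm_num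
        linarith
  have hsub : {ω : Sym2 (Fin n) → Prop | ¬ ConcentratedDegrees (p : ℝ)
        fun i => ((SimpleGraph.fromEdgeSet {e | ω e}).neighborSet i).ncard} ⊆
      (⋃ i ∈ Finset.univ, {ω | 6 / 25 * (erWidth n : ℝ) ≤
        |∑ e ∈ F i, edgeIndicator (ω e) - p * (F i).card|}) ∪
      {ω | (n : ℝ) ≤ |∑ e ∈ E, edgeIndicator (ω e) - p * E.card|} := by
    intro ω hω
    by_contra hout
    simp only [Set.mem_union, Set.mem_iUnion, not_or, not_exists, Set.mem_ofPred_eq, not_le] at hout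
    refine hω ⟨fun i => ?_, ?_⟩
    · have := hout.1 i (Finset.mem_univ i)
      rw [card_image_erase] at this
      rw [ncard_neighborSet_fromEdgeSet]
      exact this.le
    · have := hout.2
      rw [card_filter_not_isDiag] at this
      rw [sum_ncard_neighborSet_fromEdgeSet]
      calc _ = |2 * (∑ e ∈ E, edgeIndicator (ω e) - p * (n * (n - 1) / 2))| := by
            congr 1; ring
        _ ≤ 2 * n := by
            rw [abs_mul, abs_two]
            linarith
  calc _ ≤ (∑ i : Fin n, μ.real {ω | 6 / 25 * (erWidth n : ℝ) ≤
        |∑ e ∈ F i, edgeIndicator (ω e) - p * (F i).card|}) + 1 / 20 :=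
        (measureReal_mono hsub).trans ((measureReal_union_le _ _).trans
          (add_le_add (measureReal_biUnion_finset_le _ _) hE))
    _ ≤ (∑ _i : Fin n, (2 / (10 * n) : ℝ)) + 1 / 20 := by
        gcongr with i
        exact hF i
    _ = 1 / 4 := by
        simp only [Finset.sum_const, Finset.card_univ, Fintype.card_fin, nsmul_eq_mul]
        field_simp
        norm_num

/-! ### The noise of the reports -/

/-- Since `n ≤ s²`, the variance is at most `8` times the squared privacy factor, and `144 / (2 · 8)
= 9`. -/
theorem measureReal_blurError_sqrt_le {n s : ℕ} (hn : 1 ≤ n) (hs : 0 < s) (hns : n ≤ s ^ 2)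
    {ε δ : ℝ} (hε : 0 < ε) (hδ : 0 < δ) (hδ' : δ ≤ 1 / 2) (G : SimpleGraph (Fin n)) (j : ℤ)
    {a : ℝ} (ha : 0 < a) :
    (jointReports (fun _ N => blurReport ε δ n s N) G).real
      {r | 12 * Real.sqrt (a / n) * privacyFactor ε δ ≤ |blurError s G j r|} ≤
      2 * Real.exp (-(9 * a)) := by
  have hn' : (0 : ℝ) < n := by exact_mod_cast hn
  have hs' : (0 : ℝ) < s := by exact_mod_cast hs
  have hv := noiseVariance_pos n s hε hδ hδ'
  have hpf : 0 < privacyFactor ε δ :=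
    div_pos (Real.sqrt_pos.2 ((Real.log_pos one_lt_two).trans_le
      (log_two_le_log_one_div hδ hδ'))) hε
  refine (measureReal_blurError_le hn hs ε δ G j (by positivity)).trans ?_
  gcongr
  rw [le_div_iff₀ (by positivity), mul_pow, mul_pow, Real.sq_sqrt (by positivity),
    coe_noiseVariance]
  have h : (n : ℝ) / (s : ℝ) ^ 2 ≤ 1 := by
    rw [div_le_one (by positivity)]
    exact_mod_cast hns
  calc 9 * a * (2 * (4 * (1 + (n : ℝ) / (s : ℝ) ^ 2) * privacyFactor ε δ ^ 2))
      ≤ 9 * a * (2 * (4 * (1 + 1) * privacyFactor ε δ ^ 2)) := by gcongr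
    _ = _ := by field_simp; norm_num

/-- With `y = n/s ≥ 2`, the uniform bound is a union over at most `2y` cells, each failing with
probability at most `2 y⁻⁹`. The local bound is a union over ten integers around the deterministic
`X`, with no logarithmic loss. -/
theorem measureReal_large_blurError_le {n s : ℕ} (hn : 1 ≤ n) (hs : 0 < s) (hns : n ≤ s ^ 2)
    (hsn : 2 * s ≤ n) {ε δ : ℝ} (hε : 0 < ε) (hδ : 0 < δ) (hδ' : δ ≤ 1 / 2)
    (G : SimpleGraph (Fin n)) (X : ℝ) :
    (jointReports (fun _ N => blurReport ε δ n s N) G).real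
      {r | ¬ ((∀ j : ℤ, |blurError s G j r| ≤
          12 * Real.sqrt (Real.log ((n : ℝ) / s) / n) * privacyFactor ε δ) ∧
        ∀ j : ℤ, |(j : ℝ) - X| < 4 → |blurError s G j r| ≤
          12 * Real.sqrt (1 / n) * privacyFactor ε δ)} ≤ 1 / 10 := by
  have hn' : (0 : ℝ) < n := by exact_mod_cast hn
  have hs' : (0 : ℝ) < s := by exact_mod_cast hs
  obtain ⟨y, hy⟩ : ∃ y, y = (n : ℝ) / s := ⟨_, rfl⟩
  have hy2 : 2 ≤ y := by
    rw [hy, le_div_iff₀ hs']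
    exact_mod_cast hsn
  have hlog : 0 < Real.log y := Real.log_pos (by linarith)
  have hpf : 0 ≤ privacyFactor ε δ := div_nonneg (Real.sqrt_nonneg _) hε.le
  rw [← hy]
  obtain ⟨μ, hμ⟩ : ∃ μ, μ = jointReports (fun _ N => blurReport ε δ n s N) G := ⟨_, rfl⟩
  have : IsProbabilityMeasure μ := hμ ▸ inferInstance
  have htail := fun j a ha =>
    measureReal_blurError_sqrt_le hn hs hns hε hδ hδ' G j (a := a) ha
  rw [← hμ] at htail ⊢
  have hsub : {r | ¬ ((∀ j : ℤ, |blurError s G j r| ≤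
          12 * Real.sqrt (Real.log y / n) * privacyFactor ε δ) ∧
        ∀ j : ℤ, |(j : ℝ) - X| < 4 → |blurError s G j r| ≤
          12 * Real.sqrt (1 / n) * privacyFactor ε δ)} ⊆
      (⋃ j ∈ Finset.range (numCells n s),
        {r | 12 * Real.sqrt (Real.log y / n) * privacyFactor ε δ ≤ |blurError s G (j : ℤ) r|}) ∪
      ⋃ j ∈ Finset.Icc (⌊X⌋ - 4) (⌊X⌋ + 5),
        {r | 12 * Real.sqrt (1 / n) * privacyFactor ε δ ≤ |blurError s G j r|} := by
    intro r hr
    by_contra hout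
    simp only [Set.mem_union, Set.mem_iUnion, not_or, not_exists, Set.mem_ofPred_eq, not_le] at hout
    refine hr ⟨fun j => ?_, fun j hj => ?_⟩
    · by_cases h : j < 0 ∨ (numCells n s : ℤ) ≤ j
      · rw [blurError, padZero_of_out_of_range _ h,
          blurryDegree_eq_zero (ncard_neighborSet_lt G) hs h, sub_zero, abs_zero]
        positivity
      · push Not at h
        obtain ⟨k, rfl⟩ := Int.eq_ofNat_of_zero_le h.1
        exact (hout.1 k (Finset.mem_range.2 (by exact_mod_cast h.2))).le
    · refine (hout.2 j (Finset.mem_Icc.2 ?_)).le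
      have h1 := Int.floor_le X
      have h2 := Int.lt_floor_add_one X
      rw [abs_lt] at hj
      have h3 : (⌊X⌋ - 4 : ℤ) < (j : ℝ) := by push_cast; linarith
      have h4 : (j : ℝ) < (⌊X⌋ + 5 : ℤ) := by push_cast; linarith
      exact ⟨(Int.cast_lt.1 h3).le, (Int.cast_lt.1 h4).le⟩
  have hm : (numCells n s : ℝ) ≤ 2 * y := by
    unfold numCells
    push_cast
    rw [← hy]
    linarith [Nat.ceil_lt_add_one (by linarith : 0 ≤ y)]
  have hexp : Real.exp (-(9 * Real.log y)) ≤ 1 / (256 * y) := by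
    have : 9 * Real.log y = Real.log (y ^ 9) := by rw [Real.log_pow]; norm_num
    rw [this, Real.exp_neg, Real.exp_log (by positivity), ← one_div]
    refine one_div_le_one_div_of_le (by positivity) ?_
    calc 256 * y = 2 ^ 8 * y := by norm_num
      _ ≤ y ^ 8 * y := by gcongr
      _ = y ^ 9 := by ring
  have hexp' : Real.exp (-(9 * 1)) ≤ 1 / 512 := by
    have : (2 : ℝ) ^ 9 ≤ Real.exp 1 ^ 9 := by
      gcongr; linarith [Real.exp_one_gt_d9]
    rw [Real.exp_one_pow] at this
    rw [Real.exp_neg, ← one_div]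
    refine one_div_le_one_div_of_le (by positivity) ?_
    norm_num at this ⊢
    exact this
  calc _ ≤ (∑ _j ∈ Finset.range (numCells n s), 2 * Real.exp (-(9 * Real.log y))) +
        ∑ _j ∈ Finset.Icc (⌊X⌋ - 4) (⌊X⌋ + 5), 2 * Real.exp (-(9 * 1)) :=
        (measureReal_mono hsub).trans ((measureReal_union_le _ _).trans (add_le_add
          ((measureReal_biUnion_finset_le _ _).trans
            (Finset.sum_le_sum fun j _ => htail j _ hlog))
          ((measureReal_biUnion_finset_le _ _).trans
            (Finset.sum_le_sum fun j _ => htail j _ one_pos))))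
    _ ≤ 2 * y * (2 * (1 / (256 * y))) + 10 * (2 * (1 / 512)) := by
        simp only [Finset.sum_const, Finset.card_range, Int.card_Icc, nsmul_eq_mul]
        have : ((⌊X⌋ + 5 + 1 - (⌊X⌋ - 4)).toNat : ℝ) = 10 := by
          have : (⌊X⌋ + 5 + 1 - (⌊X⌋ - 4)).toNat = 10 := by omega
          rw [this]; norm_num
        rw [this]
        gcongr
    _ ≤ 1 / 10 := by
        field_simp
        norm_num

/-! ### Accuracy of the estimator -/

theorem two_mul_erWidth_le {n : ℕ} (hn : 2000000 ≤ n) : 2 * erWidth n ≤ n := by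
  have hn' : (2000000 : ℝ) ≤ n := by exact_mod_cast hn
  have hlt : (erWidth n : ℝ) < 2 * Real.sqrt (3 * n * Real.log (10 * n)) + 1 :=
    Nat.ceil_lt_add_one (by positivity)
  obtain ⟨w, hw⟩ : ∃ w, w = Real.sqrt (10 * n) := ⟨_, rfl⟩
  have hw2 : w ^ 2 = 10 * n := by rw [hw, Real.sq_sqrt (by positivity)]
  have hw0 : 0 ≤ w := hw ▸ Real.sqrt_nonneg _
  -- From `log(10n) = 2 log w ≤ 2w` and `n/192 = w²/1920`, it suffices that `w ≥ 3840`; the lower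
  -- bound on `n` ensures this.
  have hlog : Real.log (10 * n) ≤ n / 192 := by
    rw [← hw2, Real.log_pow]
    have h1 := Real.log_le_self hw0
    have h2 : 3840 ≤ w := by nlinarith
    push_cast
    nlinarith
  have hsqrt : Real.sqrt (3 * n * Real.log (10 * n)) ≤ n / 8 := by
    rw [Real.sqrt_le_left (by positivity)]
    nlinarith
  have : (2 * erWidth n : ℝ) ≤ n := by linarith
  exact_mod_cast this

theorem erWidth_le {n : ℕ} (hn : 10 ≤ n) :
    (erWidth n : ℝ) ≤ 10 * Real.sqrt n * Real.sqrt (Real.log n) := by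
  have hn' : (10 : ℝ) ≤ n := by exact_mod_cast hn
  have hlt : (erWidth n : ℝ) < 2 * Real.sqrt (3 * n * Real.log (10 * n)) + 1 :=
    Nat.ceil_lt_add_one (by positivity)
  have h10 : (1 : ℝ) ≤ Real.log 10 := by
    rw [Real.le_log_iff_exp_le (by norm_num)]
    linarith [Real.exp_one_lt_d9]
  have hmul : Real.log (10 * n) = Real.log 10 + Real.log n :=
    Real.log_mul (by norm_num) (by positivity)
  have hle : Real.log 10 ≤ Real.log n := Real.log_le_log (by norm_num) hn'
  have h1 : 1 ≤ 2 * Real.sqrt (3 * n * Real.log (10 * n)) := by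
    have : 1 ≤ Real.sqrt (3 * n * Real.log (10 * n)) := by
      rw [Real.one_le_sqrt]
      nlinarith
    linarith
  have h2 : 4 * Real.sqrt (3 * n * Real.log (10 * n)) ≤
      10 * (Real.sqrt n * Real.sqrt (Real.log n)) := by
    rw [← Real.sqrt_mul (by positivity)]
    have h4 : (4 : ℝ) = Real.sqrt 16 := by
      rw [show (16 : ℝ) = 4 ^ 2 by norm_num, Real.sqrt_sq (by norm_num)]
    have h100 : (10 : ℝ) = Real.sqrt 100 := by
      rw [show (100 : ℝ) = 10 ^ 2 by norm_num, Real.sqrt_sq (by norm_num)]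
    calc 4 * Real.sqrt (3 * n * Real.log (10 * n))
        = Real.sqrt (16 * (3 * n * Real.log (10 * n))) := by
          rw [Real.sqrt_mul (by norm_num : (0 : ℝ) ≤ 16), ← h4]
      _ ≤ Real.sqrt (100 * (n * Real.log n)) := by
          apply Real.sqrt_le_sqrt
          nlinarith
      _ = 10 * Real.sqrt (n * Real.log n) := by
          rw [Real.sqrt_mul (by norm_num : (0 : ℝ) ≤ 100), ← h100]
  linarith

theorem le_erWidth_sq {n : ℕ} (hn : 1 ≤ n) : n ≤ erWidth n ^ 2 := by
  have h1 : (1 : ℝ) ≤ n := by exact_mod_cast hn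
  have h := twelve_mul_le_erWidth_sq hn
  have h10 : (1 : ℝ) ≤ Real.log (10 * n) := by
    rw [Real.le_log_iff_exp_le (by linarith)]
    linarith [Real.exp_one_lt_d9]
  have : (n : ℝ) ≤ (erWidth n : ℝ) ^ 2 := by nlinarith
  exact_mod_cast this

/-- Bounds the target error below, so that additive constants can be absorbed into it. -/
theorem four_fifths_le_privacyFactor {ε δ : ℝ} (hε : 0 < ε) (hε' : ε ≤ 1) (hδ : 0 < δ)
    (hδ' : δ ≤ 1 / 2) : 4 / 5 ≤ privacyFactor ε δ := by
  unfold privacyFactor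
  rw [le_div_iff₀ hε]
  have : 4 / 5 ≤ Real.sqrt (Real.log (1 / δ)) := by
    apply Real.le_sqrt_of_sq_le
    linarith [log_two_le_log_one_div hδ hδ', Real.log_two_gt_d9]
  linarith

/-- The lower bound on `ε` serves accuracy here: `24 / 1200 = 1/50` is the largest threshold that
the selection argument tolerates. -/
theorem threshold_le {n s : ℕ} {ε δ : ℝ} (hs : 0 < s) (hsn : s ≤ n) (hε : 0 < ε)
    (hε' : 1200 * Real.sqrt (Real.log (n : ℝ) * Real.log (1 / δ) / (n : ℝ)) ≤ ε) :
    24 * Real.sqrt (Real.log ((n : ℝ) / s) / n) * privacyFactor ε δ ≤ 1 / 50 := by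
  have hs' : (1 : ℝ) ≤ s := by exact_mod_cast hs
  have hn' : (1 : ℝ) ≤ n := by exact_mod_cast hs.trans_le hsn
  have hlog : Real.log ((n : ℝ) / s) ≤ Real.log n :=
    Real.log_le_log (by positivity) (div_le_self (by positivity) hs')
  have hlogn : 0 ≤ Real.log (n : ℝ) := Real.log_nonneg hn'
  unfold privacyFactor
  rw [← mul_div_assoc, div_le_iff₀ hε]
  have h : Real.sqrt (Real.log (n : ℝ) * Real.log (1 / δ) / (n : ℝ)) =
      Real.sqrt (Real.log n / n) * Real.sqrt (Real.log (1 / δ)) := by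
    rw [← Real.sqrt_mul (by positivity)]
    congr 1
    ring
  rw [h] at hε'
  have h2 : Real.sqrt (Real.log ((n : ℝ) / s) / n) * Real.sqrt (Real.log (1 / δ)) ≤
      Real.sqrt (Real.log n / n) * Real.sqrt (Real.log (1 / δ)) := by gcongr
  linarith

theorem abs_erServer_sub_le {n : ℕ} {ε δ p : ℝ} (hn : 2000000 ≤ n) (hε : 0 < ε) (hε' : ε ≤ 1)
    (hδ : 0 < δ) (hδ' : δ ≤ 1 / 2)
    (hεn : 1200 * Real.sqrt (Real.log (n : ℝ) * Real.log (1 / δ) / (n : ℝ)) ≤ ε)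
    (hp : p ∈ Set.Icc (0 : ℝ) 1) {G : SimpleGraph (Fin n)}
    (hG : ConcentratedDegrees p fun i => (G.neighborSet i).ncard)
    {r : Fin n → Fin (numCells n (erWidth n)) → ℝ}
    (hr : ∀ j : ℤ, |blurError (erWidth n) G j r| ≤
      12 * Real.sqrt (Real.log ((n : ℝ) / erWidth n) / n) * privacyFactor ε δ)
    (hr' : ∀ j : ℤ, |(j : ℝ) - p * (n - 1) / erWidth n| < 4 → |blurError (erWidth n) G j r| ≤
      12 * Real.sqrt (1 / n) * privacyFactor ε δ) :
    |erServer 24 ε δ n r - p| ≤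
      1300 * (Real.sqrt (Real.log n) / n * privacyFactor ε δ) := by
  have hn1 : 1 ≤ n := by omega
  have hn' : (2000000 : ℝ) ≤ n := by exact_mod_cast hn
  have hn0 : (0 : ℝ) < n := by linarith
  have hs := erWidth_pos hn1
  have hs' : (0 : ℝ) < erWidth n := by exact_mod_cast hs
  have hsn := two_mul_erWidth_le hn
  have hpf := four_fifths_le_privacyFactor hε hε' hδ hδ'
  have hlogy : 0 < Real.log ((n : ℝ) / erWidth n) := by
    apply Real.log_pos
    rw [one_lt_div hs']
    exact_mod_cast (by omega : erWidth n < n)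
  have hτ0 : 0 < 24 * Real.sqrt (Real.log ((n : ℝ) / erWidth n) / n) * privacyFactor ε δ := by
    positivity
  have hX : ∀ i, |((G.neighborSet i).ncard : ℝ) / erWidth n - p * (n - 1) / erWidth n| ≤
      6 / 25 := by
    intro i
    rw [← sub_div, abs_div, abs_of_pos hs', div_le_iff₀ hs']
    exact hG.1 i
  have hmain := abs_concDegServer_sub_le hn1 hs (ncard_neighborSet_lt G) hX
    (fun k => (∑ i, r i k) / (n : ℝ)) rfl hτ0 (threshold_le hs (by omega) hε hεn)
    (fun j => (hr j).trans (by linarith)) hr'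
  obtain ⟨y, hy⟩ : ∃ y, y =
    (concDegServer 24 ε δ n (erWidth n) fun k => (∑ i, r i k) / (n : ℝ)).1 +
    (concDegServer 24 ε δ n (erWidth n) fun k => (∑ i, r i k) / (n : ℝ)).2 := ⟨_, rfl⟩
  rw [← hy] at hmain
  have hlogn : 1 ≤ Real.sqrt (Real.log n) := by
    rw [Real.one_le_sqrt, Real.le_log_iff_exp_le hn0]
    linarith [Real.exp_one_lt_d9]
  have havg : |(∑ i, ((G.neighborSet i).ncard : ℝ)) / n - p * (n - 1)| ≤ 2 := by
    have : (∑ i, ((G.neighborSet i).ncard : ℝ)) / n - p * (n - 1) =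
        (∑ i, ((G.neighborSet i).ncard : ℝ) - p * (n * (n - 1))) / n := by
      field_simp
    rw [this, abs_div, abs_of_pos hn0, div_le_iff₀ hn0]
    exact hG.2
  have hnoise : 10 * (erWidth n : ℝ) * (12 * Real.sqrt (1 / n) * privacyFactor ε δ) ≤
      1200 * (Real.sqrt (Real.log n) * privacyFactor ε δ) := by
    calc _ ≤ 10 * (10 * Real.sqrt n * Real.sqrt (Real.log n)) *
          (12 * Real.sqrt (1 / n) * privacyFactor ε δ) := by
          gcongr
          exact erWidth_le (by omega)
      _ = 1200 * (Real.sqrt n * Real.sqrt (1 / n)) *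
          (Real.sqrt (Real.log n) * privacyFactor ε δ) := by ring
      _ = _ := by
          rw [← Real.sqrt_mul hn0.le, mul_one_div_cancel hn0.ne', Real.sqrt_one, mul_one]
  have hprod : 4 / 5 ≤ Real.sqrt (Real.log n) * privacyFactor ε δ := by nlinarith
  have h1 := abs_le.1 hmain
  have h2 := abs_le.1 havg
  have hserver : erServer 24 ε δ n r = y / n := by rw [hy]; rfl
  have hdiff : y / n - p = (y - p * n) / n := by field_simp
  rw [hserver, hdiff, abs_div, abs_of_pos hn0, div_mul_eq_mul_div, ← mul_div_assoc]
  -- The noise contributes 1200 units; the remaining 100 units, at least 80, absorb the deviation 2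
  -- of the average degree and the difference `p ≤ 1` between `p n` and `p (n - 1)`.
  gcongr
  rw [abs_le]
  constructor <;> linarith [hp.1, hp.2]

theorem le_erEstimator_of_concentratedDegrees {n : ℕ} {ε δ p : ℝ} (hn : 2000000 ≤ n) (hε : 0 < ε)
    (hε' : ε ≤ 1) (hδ : 0 < δ) (hδ' : δ ≤ 1 / 2)
    (hεn : 1200 * Real.sqrt (Real.log (n : ℝ) * Real.log (1 / δ) / (n : ℝ)) ≤ ε)
    (hp : p ∈ Set.Icc (0 : ℝ) 1) {G : SimpleGraph (Fin n)}
    (hG : ConcentratedDegrees p fun i => (G.neighborSet i).ncard) :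
    ENNReal.ofReal (9 / 10) ≤ erEstimator 24 ε δ n G
      {x : ℝ | |x - p| ≤ 1300 * (Real.sqrt (Real.log n) / n * privacyFactor ε δ)} := by
  rw [erEstimator_eq_map, Measure.map_apply (measurable_erServer _ _ _ _)
    (measurableSet_le (by fun_prop) measurable_const)]
  rw [show (9 / 10 : ℝ) = 1 - 1 / 10 by norm_num]
  refine ofReal_one_sub_le_measure (fun r hr => ?_)
    (measureReal_large_blurError_le (by omega) (erWidth_pos (by omega)) (le_erWidth_sq (by omega))
      (two_mul_erWidth_le hn) hε hδ hδ' G (p * (n - 1) / erWidth n))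
  simp only [Set.mem_ofPred_eq, not_not] at hr
  exact abs_erServer_sub_le hn hε hε' hδ hδ' hεn hp hG hr.1 hr.2

/-- Makes the finite space of graphs on `Fin n` discrete, so the success probability is a measurable
function of the graph. -/
instance {V : Type*} [Countable V] : MeasurableSingletonClass (SimpleGraph V) where
  measurableSet_singleton G := by
    have h : ({G} : Set (SimpleGraph V)) = SimpleGraph.edgeSet ⁻¹' {G.edgeSet} := by
      ext; simp
    rw [h]
    exact SimpleGraph.measurable_edgeSet (measurableSet_singleton _)

theorem measurable_fromEdgeSet_setOf {V : Type*} :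
    Measurable fun ω : Sym2 V → Prop => SimpleGraph.fromEdgeSet {e | ω e} :=
  SimpleGraph.measurable_fromEdgeSet.comp MeasurableEquiv.setOfPred.measurable

theorem two_thirds_le_lintegral_erEstimator {n : ℕ} {ε δ : ℝ} (hn : 2000000 ≤ n) (hε : 0 < ε)
    (hε' : ε ≤ 1) (hδ : 0 < δ) (hδ' : δ ≤ 1 / 2)
    (hεn : 1200 * Real.sqrt (Real.log (n : ℝ) * Real.log (1 / δ) / (n : ℝ)) ≤ ε)
    (p : unitInterval) :
    (2 / 3 : ENNReal) ≤ ∫⁻ G, erEstimator 24 ε δ n G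
      {x : ℝ | |x - p| ≤ 1300 * (Real.sqrt (Real.log n) / n * privacyFactor ε δ)}
      ∂(SimpleGraph.binomialRandom (Fin n) p) := by
  obtain ⟨F, hF⟩ : ∃ F : SimpleGraph (Fin n) → ENNReal, F = fun G => erEstimator 24 ε δ n G
    {x : ℝ | |x - p| ≤ 1300 * (Real.sqrt (Real.log n) / n * privacyFactor ε δ)} := ⟨_, rfl⟩
  have hFm : Measurable F := .of_discrete
  have hm := measurable_fromEdgeSet_setOf (V := Fin n)
  rw [binomialRandom_eq_map_infinitePi]
  change _ ≤ ∫⁻ G, (fun G => erEstimator 24 ε δ n G _) G ∂_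
  rw [← hF, lintegral_map hFm hm]
  -- Markov's inequality combines the two sources of failure: `9/10 · 3/4 = 27/40 ≥ 2/3`.
  refine le_trans ?_ (mul_meas_ge_le_lintegral (hFm.comp hm) (ENNReal.ofReal (9 / 10)))
  have h := ofReal_one_sub_le_measure (μ := Measure.infinitePi (edgeLaw (V := Fin n) p))
    (A := {ω | ENNReal.ofReal (9 / 10) ≤ (F ∘ fun ω => SimpleGraph.fromEdgeSet {e | ω e}) ω})
    (fun ω hω => by
      simp only [Set.mem_ofPred_eq, not_not] at hω
      simp only [Set.mem_ofPred_eq, Function.comp, hF]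
      exact le_erEstimator_of_concentratedDegrees hn hε hε' hδ hδ' hεn p.2 hω)
    (measureReal_not_concentratedDegrees_le (by omega) p)
  calc (2 / 3 : ENNReal) = ENNReal.ofReal (2 / 3) := by
        rw [ENNReal.ofReal_div_of_pos (by norm_num)]; simp
    _ ≤ ENNReal.ofReal (9 / 10 * (1 - 1 / 4)) := ENNReal.ofReal_le_ofReal (by norm_num)
    _ = ENNReal.ofReal (9 / 10) * ENNReal.ofReal (1 - 1 / 4) :=
        ENNReal.ofReal_mul (by norm_num)
    _ ≤ _ := by gcongr

end NodeLDP

theorem mainTheorem4 :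
    ∃ c c₁ C : ℝ, 0 < c ∧ 0 < c₁ ∧ 0 < C ∧ ∃ n₀ : ℕ,
      ∀ (n : ℕ) (ε δ : ℝ), 1 ≤ n → 0 < δ → δ ≤ 1 / 2 → 0 < ε → ε ≤ 1 →
        c * Real.sqrt (Real.log (n : ℝ) * Real.log (1 / δ) / (n : ℝ)) ≤ ε →
        NodeLDP.IsLNDP ε δ (NodeLDP.erEstimator c₁ ε δ n) ∧
        (n₀ ≤ n → ∀ p : unitInterval,
          (2 / 3 : ENNReal) ≤
            ∫⁻ G, NodeLDP.erEstimator c₁ ε δ n G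
              {x : ℝ | |x - (p : ℝ)| ≤
                C * (Real.sqrt (Real.log (n : ℝ)) / (n : ℝ) * NodeLDP.privacyFactor ε δ)}
              ∂(SimpleGraph.binomialRandom (Fin n) p)) :=
  ⟨1200, 24, 1300, by norm_num, by norm_num, by norm_num, 2000000,
    fun _ _ _ hn hδ hδ' hε hε' hεn => ⟨NodeLDP.isLNDP_erEstimator 24 hn hε hε' hδ hδ',
      fun hn' p => NodeLDP.two_thirds_le_lintegral_erEstimator hn' hε hε' hδ hδ' hεn p⟩⟩
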